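/- Let $n\ge 1$ be an integer, $\alpha>0$, and let $f:[0,\alpha)\to\mathbb R$ be continuous and $n$-convex on $[0,\alpha)$ with $f(0)\le 0$; here $n$-convex means that $$f(\lambda A+(1-\lambda)B)\le \lambda f(A)+(1-\lambda)f(B)$$ for all $\lambda\in[0,1]$ and all self-adjoint complex $n\times n$ matrices $A,B$ whose eigenvalues lie in $[0,\alpha)$. Put $g(t)=f(t)/t$ for $t\in(0,\alpha)$. Then: (1) Let $G:[0,\alpha)\to\mathbb R$ be any function with $G'=g$ on $(0,\alpha)$ (an antiderivative $\int g$ of $g$). At every $t\in[0,\alpha)$ at which $G$ is $2n$ times differentiable (at $t=0$: in the one-sided sense, if the one-sided derivatives exist), the Hankel matrix $$K_n(G;t)=\left(\frac{G^{(i+j)}(t)}{(i+j)!}\right)_{1\le i,j\le n}$$ is positive semidefinite. (2) If $n=2$, then $g$ belongs to the class $Q_2(0,\alpha)$, that is, $g$ is continuously differentiable on $(0,\alpha)$ and, for all $\lambda_1,\lambda_2\in(0,\alpha)$, the Loewner matrix $([\lambda_i,\lambda_j]_g)_{1\le i,j\le 2}$, where $[s,t]_g=\frac{g(s)-g(t)}{s-t}$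 for $s\ne t$ and $[s,s]_g=g'(s)$, is conditionally positive definite: $(x\mid ([\lambda_i,\lambda_j]_g)x)\ge 0$ for every $x=(x_1,x_2)\in\mathbb C^2$ with $x_1+x_2=0$. -/

import Mathlib

open Set Filter Topology
open scoped ComplexOrder

noncomputable section

/-- `f` is `n`-convex (matrix convex of order `n`) on `I`: for all self-adjoint complex `n × n`
matrices `A`, `B` with all eigenvalues in `I` and all `l ∈ [0, 1]`,
`f (l A + (1 - l) B) ≤ l f(A) + (1 - l) f(B)` in the positive semidefinite order.
Here `f(A)` is the functional calculus `cfc f A`. -/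
def MatrixConvexOn (n : ℕ) (I : Set ℝ) (f : ℝ → ℝ) : Prop :=
  ∀ A B : Matrix (Fin n) (Fin n) ℂ, A.IsHermitian → B.IsHermitian →
    spectrum ℝ A ⊆ I → spectrum ℝ B ⊆ I →
    ∀ l ∈ Icc (0 : ℝ) 1,
      ((l • cfc f A + (1 - l) • cfc f B) - cfc f (l • A + (1 - l) • B)).PosSemidef

/-- A complex square matrix is conditionally positive definite (almost positive) if it is
Hermitian and `(x | A x) ≥ 0` for every vector `x` whose entries sum to zero. -/
def CondPosDef {n : ℕ} (A : Matrix (Fin n) (Fin n) ℂ) : Prop :=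
  A.IsHermitian ∧
    ∀ x : Fin n → ℂ, ∑ i, x i = 0 → 0 ≤ (dotProduct (star x) (A.mulVec x)).re

/-- The Loewner matrix `([p i, p j]_h)`, with `[s, s]_h = h' s` and
`[s, t]_h = (h t - h s) / (t - s)` for `s ≠ t` (this is Mathlib's `dslope`). -/
def loewnerMatrix {n : ℕ} (h : ℝ → ℝ) (p : Fin n → ℝ) : Matrix (Fin n) (Fin n) ℂ :=
  Matrix.of fun i j => ((dslope h (p i) (p j) : ℝ) : ℂ)

/-- The class `Q_n(a, b)`: functions that are `C¹` on `(a, b)` and all of whose `n × n` Loewner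
matrices at points of `(a, b)` (not necessarily distinct) are conditionally positive definite. -/
def ClassQ (n : ℕ) (a b : ℝ) : Set (ℝ → ℝ) :=
  {h | ContDiffOn ℝ 1 h (Ioo a b) ∧
    ∀ p : Fin n → ℝ, (∀ i, p i ∈ Ioo a b) → CondPosDef (loewnerMatrix h p)}

/-- `G` is `m` times differentiable at `t` relative to `S` (no continuity of the last derivative is
required): the derivatives of order `< m - 1` are differentiable in `S` near `t`, and the one of
order `m - 1` is differentiable at `t`. -/
def TimesDifferentiableWithinAt (m : ℕ) (G : ℝ → ℝ) (S : Set ℝ) (t : ℝ) : Prop :=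
  ∀ k < m, DifferentiableWithinAt ℝ (iteratedDerivWithin k G S) S t ∧
    (k + 1 < m → ∀ᶠ s in 𝓝[S] t, DifferentiableWithinAt ℝ (iteratedDerivWithin k G S) S s)

/-- The Hankel matrix `K_n(G; t) = (G^{(i+j)}(t) / (i+j)!)`, `1 ≤ i, j ≤ n`, with derivatives
relative to `S`; as `Fin n` counts from `0`, the order `i + j` reads `(i + 1) + (j + 1)`. -/
def hankelK (n : ℕ) (G : ℝ → ℝ) (S : Set ℝ) (t : ℝ) : Matrix (Fin n) (Fin n) ℝ :=
  Matrix.of fun i j =>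
    iteratedDerivWithin ((i.val + 1) + (j.val + 1)) G S t /
      (Nat.factorial ((i.val + 1) + (j.val + 1)) : ℝ)

end

/-! Suppose first that `f` is replaced by a smooth `n`-convex `F` with `F 0 ≤ 0`. Midpoint convexity
at two perturbations of `t·1`, tested on a vector and compared with the Taylor expansion of `F` at
`t`, gives positivity of the Hankel form with entries `F^(i+j)(t)/(i+j)!`, `1 ≤ i, j ≤ n`
(`MatrixConvexOn.hankel_nonneg`). The perturbations are tuned so that the lowest surviving order of
the second difference is exactly this form.

This passes to `g = F/t` because `(t^(l+1) g^(l))' = t^l F^(l+1)`. Hence a rescaled Hankel form of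
the antiderivative of `g` is nondecreasing in `t`. Its limit at `0` is `-F 0` times a form with Gram
matrix `1/(i+j)`, which is nonnegative. This is where `F 0 ≤ 0` enters (`quotDeriv_hankel_nonneg`).

A general `f` is a uniform limit of such `F` on `[0, β]`, `β < α`
(`MatrixConvexOn.exists_smooth_approx`). Integrated by parts against a nonnegative bump on `[t + ε,
t + 2ε]`, the inequality for `F` involves only values of `F`, so it survives the limit. If `G` has
`2n` derivatives at `t`, then `g` has a Peano expansion of degree `2n - 1` there, and `ε → 0`
recovers the pointwise form. The bump lies to the right of `t`, so `t = 0` needs no separate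
treatment.

For `n = 2`, the last diagonal entry says `g''' ≥ 0` in the limit sense: `s ↦ g (s + h) - g s` is
convex. So the right derivative of `g` is convex, hence continuous, and `g` is `C¹` with convex
derivative. Conditional positivity of a `2 × 2` Loewner matrix is then the trapezoid inequality for
`g'`. -/

/-- The real part of the quadratic form `(x | M x)`. -/
noncomputable def quadForm {n : ℕ} (M : Matrix (Fin n) (Fin n) ℂ) (x : Fin n → ℂ) : ℝ :=
  (dotProduct (star x) (M.mulVec x)).re

/-! ### Quadratic forms of the functional calculus. -/

section QuadForm

variable {n : ℕ}

lemma quadForm_add (M N : Matrix (Fin n) (Fin n) ℂ) (x : Fin n → ℂ) :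
    quadForm (M + N) x = quadForm M x + quadForm N x := by
  simp [quadForm, Matrix.add_mulVec, dotProduct_add]

lemma quadForm_sub (M N : Matrix (Fin n) (Fin n) ℂ) (x : Fin n → ℂ) :
    quadForm (M - N) x = quadForm M x - quadForm N x := by
  simp [quadForm, Matrix.sub_mulVec, dotProduct_sub]

lemma quadForm_smul (r : ℝ) (M : Matrix (Fin n) (Fin n) ℂ) (x : Fin n → ℂ) :
    quadForm (r • M) x = r * quadForm M x := by
  simp [quadForm, Matrix.smul_mulVec, dotProduct_smul]

lemma posSemidef_iff_quadForm {M : Matrix (Fin n) (Fin n) ℂ} (hM : M.IsHermitian) :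
    M.PosSemidef ↔ ∀ x, 0 ≤ quadForm M x := by
  rw [Matrix.posSemidef_iff_dotProduct_mulVec]
  constructor
  · rintro ⟨-, h⟩ x
    exact (Complex.le_def.1 (h x)).1
  · refine fun h => ⟨hM, fun x => Complex.le_def.2 ⟨h x, ?_⟩⟩
    have := hM.im_star_dotProduct_mulVec_self x
    simpa using this.symm

/-- The weights do not depend on `f`, so sums, integrals and uniform bounds pass from scalar
functions to `cfc` without any continuity of `f`. -/
lemma quadForm_cfc (f : ℝ → ℝ) {A : Matrix (Fin n) (Fin n) ℂ} (hA : A.IsHermitian)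
    (x : Fin n → ℂ) :
    quadForm (cfc f A) x = ∑ k, f (hA.eigenvalues k) *
      ‖(star (hA.eigenvectorUnitary : Matrix (Fin n) (Fin n) ℂ)).mulVec x k‖ ^ 2 := by
  rw [hA.cfc_eq f, Matrix.IsHermitian.cfc, Unitary.conjStarAlgAut_apply, quadForm]
  set U : Matrix (Fin n) (Fin n) ℂ := (hA.eigenvectorUnitary : Matrix (Fin n) (Fin n) ℂ)
  have h1 : (U * Matrix.diagonal (RCLike.ofReal ∘ f ∘ hA.eigenvalues) * star U).mulVec x
      = U.mulVec ((Matrix.diagonal ((RCLike.ofReal : ℝ → ℂ) ∘ f ∘ hA.eigenvalues)).mulVec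
        ((star U).mulVec x)) := by
    simp [Matrix.mulVec_mulVec, Matrix.mul_assoc]
  have h2 : Matrix.vecMul (star x) U = star ((star U).mulVec x) := by
    rw [Matrix.star_mulVec]; simp [Matrix.star_eq_conjTranspose]
  rw [h1, Matrix.dotProduct_mulVec, h2, dotProduct, Complex.re_sum]
  refine Finset.sum_congr rfl fun k _ => ?_
  rw [Matrix.mulVec_diagonal]
  set z := (star U).mulVec x k
  have : (star z * z) = ((‖z‖ ^ 2 : ℝ) : ℂ) := by
    simpa using Complex.conj_mul' z
  simp only [Pi.star_apply, Function.comp]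
  rw [mul_left_comm, this]
  change (((f (hA.eigenvalues k) : ℝ) : ℂ) * ((‖z‖ ^ 2 : ℝ) : ℂ)).re = _
  rw [← Complex.ofReal_mul, Complex.ofReal_re]

lemma quadForm_one_eq {A : Matrix (Fin n) (Fin n) ℂ} (hA : A.IsHermitian) (x : Fin n → ℂ) :
    quadForm 1 x = ∑ k,
      ‖(star (hA.eigenvectorUnitary : Matrix (Fin n) (Fin n) ℂ)).mulVec x k‖ ^ 2 := by
  have h1 : cfc (fun _ : ℝ => (1 : ℝ)) A = 1 := cfc_const_one ℝ A hA
  have := quadForm_cfc (fun _ => (1 : ℝ)) hA x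
  rw [h1] at this
  simpa using this

lemma abs_quadForm_cfc_le {f : ℝ → ℝ} {A : Matrix (Fin n) (Fin n) ℂ} (hA : A.IsHermitian)
    {c : ℝ} (h : ∀ s ∈ spectrum ℝ A, |f s| ≤ c) (x : Fin n → ℂ) :
    |quadForm (cfc f A) x| ≤ c * quadForm 1 x := by
  rw [quadForm_cfc f hA, quadForm_one_eq hA, Finset.mul_sum]
  refine (Finset.abs_sum_le_sum_abs _ _).trans (Finset.sum_le_sum fun k _ => ?_)
  rw [abs_mul, abs_of_nonneg (sq_nonneg ‖_‖)]
  exact mul_le_mul_of_nonneg_right (h _ (hA.eigenvalues_mem_spectrum_real k)) (sq_nonneg _)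

lemma isHermitian_cfc (f : ℝ → ℝ) (A : Matrix (Fin n) (Fin n) ℂ) : (cfc f A).IsHermitian :=
  cfc_predicate f A

lemma isHermitian_real_smul {A : Matrix (Fin n) (Fin n) ℂ} (hA : A.IsHermitian) (r : ℝ) :
    (r • A).IsHermitian := by
  have : IsSelfAdjoint A := hA
  exact (IsSelfAdjoint.smul (IsSelfAdjoint.all r) this : IsSelfAdjoint (r • A))

lemma matrixConvexOn_iff_quadForm {I : Set ℝ} {f : ℝ → ℝ} :
    MatrixConvexOn n I f ↔ ∀ A B : Matrix (Fin n) (Fin n) ℂ, A.IsHermitian → B.IsHermitian →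
      spectrum ℝ A ⊆ I → spectrum ℝ B ⊆ I → ∀ l ∈ Icc (0 : ℝ) 1, ∀ x,
        quadForm (cfc f (l • A + (1 - l) • B)) x ≤
          l * quadForm (cfc f A) x + (1 - l) * quadForm (cfc f B) x := by
  unfold MatrixConvexOn
  refine forall₄_congr fun A B hA hB => forall₄_congr fun _ _ l _ => ?_
  rw [posSemidef_iff_quadForm]
  · simp [quadForm_sub, quadForm_add, quadForm_smul]
  · exact ((isHermitian_real_smul (isHermitian_cfc _ _) _).add
      (isHermitian_real_smul (isHermitian_cfc _ _) _)).sub (isHermitian_cfc _ _)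

lemma cfc_comp_add_const (f : ℝ → ℝ) (c : ℝ) {A : Matrix (Fin n) (Fin n) ℂ}
    (hA : A.IsHermitian) :
    cfc (fun s => f (s + c)) A = cfc f (A + algebraMap ℝ _ c) := by
  have hA' : IsSelfAdjoint A := hA
  have hfin := Matrix.finite_real_spectrum (A := A)
  have h1 : cfc (fun s => f (s + c)) A = cfc f (cfc (fun s => s + c) A) :=
    cfc_comp' f (fun s => s + c) A ((hfin.image _).continuousOn _) (by fun_prop) hA'
  have h2 : cfc (fun s : ℝ => s + c) A = cfc (fun s : ℝ => s) A + algebraMap ℝ _ c :=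
    cfc_add_const c (fun s => s) A (by fun_prop) hA'
  have h3 : cfc (fun s : ℝ => s) A = A := cfc_id' ℝ A hA'
  rw [h1, h2, h3]

lemma isHermitian_add_algebraMap {A : Matrix (Fin n) (Fin n) ℂ} (hA : A.IsHermitian) (c : ℝ) :
    (A + algebraMap ℝ _ c).IsHermitian := by
  refine hA.add ?_
  exact (IsSelfAdjoint.algebraMap (Matrix (Fin n) (Fin n) ℂ) (IsSelfAdjoint.all c))

lemma mem_spectrum_add_algebraMap {A : Matrix (Fin n) (Fin n) ℂ} {c s : ℝ} :
    s ∈ spectrum ℝ (A + algebraMap ℝ _ c) ↔ s - c ∈ spectrum ℝ A := by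
  have := spectrum.add_mem_add_iff (R := ℝ) (a := A) (r := s - c) (s := c)
  rwa [sub_add_cancel, add_comm] at this

lemma MatrixConvexOn.mono {I J : Set ℝ} {f : ℝ → ℝ} (h : MatrixConvexOn n I f) (hJ : J ⊆ I) :
    MatrixConvexOn n J f :=
  fun A B hA hB sA sB l hl => h A B hA hB (sA.trans hJ) (sB.trans hJ) l hl

lemma MatrixConvexOn.comp_add_const {I : Set ℝ} {f : ℝ → ℝ} (h : MatrixConvexOn n I f) (c : ℝ) :
    MatrixConvexOn n {s | s + c ∈ I} (fun s => f (s + c)) := by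
  intro A B hA hB sA sB l hl
  have hAB : (l • A + (1 - l) • B).IsHermitian :=
    (isHermitian_real_smul hA _).add (isHermitian_real_smul hB _)
  have key := h _ _ (isHermitian_add_algebraMap hA c) (isHermitian_add_algebraMap hB c)
    (fun s hs => by simpa using sA (mem_spectrum_add_algebraMap.1 hs))
    (fun s hs => by simpa using sB (mem_spectrum_add_algebraMap.1 hs)) l hl
  rw [cfc_comp_add_const f c hA, cfc_comp_add_const f c hB, cfc_comp_add_const f c hAB]
  convert key using 3
  rw [smul_add, smul_add]
  module

end QuadForm

/-! ### Smooth matrix convex approximation. -/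

section Approx

variable {n : ℕ}

lemma quadForm_one_pos {x : Fin n → ℂ} (hx : x ≠ 0) : 0 < quadForm 1 x := by
  have := (Matrix.PosDef.one (n := Fin n) (R := ℂ)).dotProduct_mulVec_pos hx
  exact (Complex.lt_def.1 this).1

lemma quadForm_mem_of_spectrum_subset_Ico {a b : ℝ} {A : Matrix (Fin n) (Fin n) ℂ}
    (hA : A.IsHermitian) (h : spectrum ℝ A ⊆ Ico a b) {x : Fin n → ℂ} (hx : x ≠ 0) :
    a * quadForm 1 x ≤ quadForm A x ∧ quadForm A x < b * quadForm 1 x := by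
  have h1 : cfc (fun s : ℝ => s) A = A := cfc_id' ℝ A hA
  have h2 := quadForm_cfc (fun s => s) hA x
  rw [h1] at h2
  have h3 := quadForm_one_pos hx
  rw [quadForm_one_eq hA] at h3 ⊢
  rw [h2, Finset.mul_sum, Finset.mul_sum]
  have hk := fun k => h (hA.eigenvalues_mem_spectrum_real k)
  refine ⟨Finset.sum_le_sum fun k _ => mul_le_mul_of_nonneg_right (hk k).1 (sq_nonneg _),
    Finset.sum_lt_sum (fun k _ => mul_le_mul_of_nonneg_right (hk k).2.le (sq_nonneg _)) ?_⟩
  obtain ⟨k, -, h4⟩ := Finset.exists_lt_of_sum_lt (s := Finset.univ) (f := fun _ : Fin n => (0 : ℝ))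
    (by simpa using h3)
  exact ⟨k, Finset.mem_univ k, mul_lt_mul_of_pos_right (hk k).2 h4⟩

/-- At an eigenvector of the combination, the eigenvalue is the same convex combination of the
Rayleigh quotients of `A` and `B`. This allows `f` to be altered outside the interval. -/
lemma spectrum_convexCombination_subset_Ico {a b : ℝ} {A B : Matrix (Fin n) (Fin n) ℂ}
    (hA : A.IsHermitian) (hB : B.IsHermitian) (sA : spectrum ℝ A ⊆ Ico a b)
    (sB : spectrum ℝ B ⊆ Ico a b) {l : ℝ} (hl : l ∈ Icc (0 : ℝ) 1) :
    spectrum ℝ (l • A + (1 - l) • B) ⊆ Ico a b := by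
  have hC : (l • A + (1 - l) • B).IsHermitian :=
    (isHermitian_real_smul hA _).add (isHermitian_real_smul hB _)
  rw [hC.spectrum_real_eq_range_eigenvalues]
  rintro _ ⟨k, rfl⟩
  set v : Fin n → ℂ := ⇑(hC.eigenvectorBasis k)
  have hv : v ≠ 0 := fun h => by
    have := hC.eigenvectorBasis.toBasis.ne_zero k
    apply this
    ext i
    simpa using congrFun h i
  have hev := hC.mulVec_eigenvectorBasis k
  have h1 : quadForm (l • A + (1 - l) • B) v = hC.eigenvalues k * quadForm 1 v := by
    rw [quadForm, hev, quadForm, dotProduct_smul, Matrix.one_mulVec]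
    simp [v]
  rw [quadForm_add, quadForm_smul, quadForm_smul] at h1
  have h2 := quadForm_mem_of_spectrum_subset_Ico hA sA hv
  have h3 := quadForm_mem_of_spectrum_subset_Ico hB sB hv
  have h4 := quadForm_one_pos hv
  obtain ⟨hl0, hl1⟩ := hl
  constructor
  · refine le_of_mul_le_mul_right ?_ h4
    rw [← h1]
    nlinarith [mul_le_mul_of_nonneg_left h2.1 hl0,
      mul_le_mul_of_nonneg_left h3.1 (sub_nonneg.2 hl1)]
  · refine lt_of_mul_lt_mul_right ?_ h4.le
    rw [← h1]
    rcases hl0.eq_or_lt with rfl | hl0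
    · simpa using h3.2
    · nlinarith [mul_lt_mul_of_pos_left h2.2 hl0,
        mul_le_mul_of_nonneg_left h3.2.le (sub_nonneg.2 hl1)]

lemma MatrixConvexOn.congr_Ico {a b : ℝ} {f g : ℝ → ℝ} (h : MatrixConvexOn n (Ico a b) f)
    (hfg : EqOn f g (Ico a b)) : MatrixConvexOn n (Ico a b) g := by
  intro A B hA hB sA sB l hl
  have := h A B hA hB sA sB l hl
  rwa [cfc_congr (hfg.mono sA), cfc_congr (hfg.mono sB),
    cfc_congr (hfg.mono (spectrum_convexCombination_subset_Ico hA hB sA sB hl))] at this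

lemma quadForm_cfc_integral (φ : ℝ → ℝ) (g : ℝ → ℝ → ℝ)
    (hg : ∀ s, MeasureTheory.Integrable (fun u => φ u * g s u))
    {A : Matrix (Fin n) (Fin n) ℂ} (hA : A.IsHermitian) (x : Fin n → ℂ) :
    MeasureTheory.Integrable (fun u => φ u * quadForm (cfc (fun s => g s u) A) x) ∧
    quadForm (cfc (fun s => ∫ u, φ u * g s u) A) x =
      ∫ u, φ u * quadForm (cfc (fun s => g s u) A) x := by
  simp_rw [quadForm_cfc _ hA, Finset.mul_sum, ← mul_assoc]
  refine ⟨MeasureTheory.integrable_finsetSum _ fun k _ => (hg _).mul_const _, ?_⟩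
  rw [MeasureTheory.integral_finsetSum _ fun k _ => (hg _).mul_const _]
  exact Finset.sum_congr rfl fun k _ => (MeasureTheory.integral_mul_const _ _).symm

lemma MatrixConvexOn.integral {I : Set ℝ} {φ : ℝ → ℝ} {g : ℝ → ℝ → ℝ} (hφ : ∀ u, 0 ≤ φ u)
    (hg : ∀ s, MeasureTheory.Integrable (fun u => φ u * g s u))
    (h : ∀ u, φ u ≠ 0 → MatrixConvexOn n I (fun s => g s u)) :
    MatrixConvexOn n I (fun s => ∫ u, φ u * g s u) := by
  rw [matrixConvexOn_iff_quadForm]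
  intro A B hA hB sA sB l hl x
  have hC : (l • A + (1 - l) • B).IsHermitian :=
    (isHermitian_real_smul hA _).add (isHermitian_real_smul hB _)
  obtain ⟨iA, eA⟩ := quadForm_cfc_integral φ g hg hA x
  obtain ⟨iB, eB⟩ := quadForm_cfc_integral φ g hg hB x
  obtain ⟨iC, eC⟩ := quadForm_cfc_integral φ g hg hC x
  rw [eA, eB, eC, ← MeasureTheory.integral_const_mul, ← MeasureTheory.integral_const_mul,
    ← MeasureTheory.integral_add (iA.const_mul l) (iB.const_mul (1 - l))]
  refine MeasureTheory.integral_mono iC ((iA.const_mul l).add (iB.const_mul (1 - l))) fun u => ?_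
  rcases eq_or_ne (φ u) 0 with h0 | h0
  · simp [h0]
  · have := mul_le_mul_of_nonneg_left
      (matrixConvexOn_iff_quadForm.1 (h u h0) A B hA hB sA sB l hl x) (hφ u)
    dsimp only at this ⊢
    linarith

lemma MatrixConvexOn.sub_const {I : Set ℝ} {f : ℝ → ℝ} (h : MatrixConvexOn n I f) (c : ℝ) :
    MatrixConvexOn n I (fun s => f s - c) := by
  have key : ∀ {A : Matrix (Fin n) (Fin n) ℂ}, A.IsHermitian → ∀ x,
      quadForm (cfc (fun s => f s - c) A) x = quadForm (cfc f A) x - c * quadForm 1 x := by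
    intro A hA x
    rw [quadForm_cfc _ hA, quadForm_cfc _ hA, quadForm_one_eq hA, Finset.mul_sum,
      ← Finset.sum_sub_distrib]
    exact Finset.sum_congr rfl fun k _ => by ring
  rw [matrixConvexOn_iff_quadForm] at h ⊢
  intro A B hA hB sA sB l hl x
  rw [key hA, key hB, key ((isHermitian_real_smul hA _).add (isHermitian_real_smul hB _))]
  linarith [h A B hA hB sA sB l hl x]

/-- Mollification averages translates of `f`, which preserves matrix convexity. A shift to the right
by `η` keeps all arguments nonnegative, and subtracting `ε / 2` restores the sign at `0`. -/
lemma MatrixConvexOn.exists_smooth_approx {α : ℝ} {f : ℝ → ℝ}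
    (hcont : ContinuousOn f (Ico 0 α)) (hconv : MatrixConvexOn n (Ico 0 α) f) (h0 : f 0 ≤ 0)
    {β : ℝ} (hβ : 0 < β) (hβα : β < α) {ε : ℝ} (hε : 0 < ε) :
    ∃ F : ℝ → ℝ, ContDiff ℝ ((⊤ : ℕ∞) : WithTop ℕ∞) F ∧ MatrixConvexOn n (Ico 0 β) F ∧ F 0 ≤ 0 ∧
      ∀ s ∈ Icc 0 β, |F s - f s| ≤ ε := by
  set γ := (β + α) / 2 with hγ
  have hγ0 : (0 : ℝ) ≤ γ := by linarith
  have hsub : Icc 0 γ ⊆ Ico 0 α := fun s hs => ⟨hs.1, by linarith [hs.2]⟩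
  set fe : ℝ → ℝ := IccExtend hγ0 ((Icc 0 γ).domRestrict f) with hfe
  have hfec : Continuous fe := (hcont.mono hsub).domRestrict.Icc_extend'
  have hfeq : EqOn f fe (Icc 0 γ) := fun s hs => by
    rw [hfe, IccExtend_of_mem _ _ hs]; rfl
  obtain ⟨δ, hδ, hu⟩ := Metric.uniformContinuousOn_iff.1
    (isCompact_Icc.uniformContinuousOn_of_continuous hfec.continuousOn : UniformContinuousOn fe
      (Icc 0 γ)) (ε / 4) (by positivity)
  -- For `|u| < η` the translation `η - u` lies in `(0, 2η)`: less than `δ` for uniform continuity,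
  -- and small enough that `s + η - u` stays below `γ` for `s ≤ β`.
  set η := min (δ / 2) ((γ - β) / 2)
  have hη : 0 < η := lt_min (by positivity) (by linarith)
  have hη1 : η ≤ δ / 2 := min_le_left _ _
  have hη2 : η ≤ (γ - β) / 2 := min_le_right _ _
  let φ : ContDiffBump (0 : ℝ) := ⟨η / 2, η, by positivity, by linarith⟩
  let ψ : ℝ → ℝ := φ.normed MeasureTheory.volume
  have hψc : Continuous ψ := φ.continuous_normed
  have hψs : HasCompactSupport ψ := φ.hasCompactSupport_normed
  have hint : ∀ s, MeasureTheory.Integrable (fun u => ψ u * fe (s + η - u)) := fun s =>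
    (hψc.mul (hfec.comp (by fun_prop))).integrable_of_hasCompactSupport hψs.mul_right
  have hcd : ContDiff ℝ ((⊤ : ℕ∞) : WithTop ℕ∞) (fun s => ∫ u, ψ u * fe (s + η - u)) := by
    have h1 := hψs.contDiff_convolution_left (ContinuousLinearMap.lsmul ℝ ℝ)
      (n := ⊤) φ.contDiff_normed (hfec.locallyIntegrable (μ := MeasureTheory.volume))
    exact h1.comp (g := fun x => MeasureTheory.convolution ψ fe (ContinuousLinearMap.lsmul ℝ ℝ)
      MeasureTheory.volume x) (contDiff_id.add contDiff_const : ContDiff ℝ ((⊤ : ℕ∞) : WithTop ℕ∞) (fun s => s + η))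
  have happ : ∀ s ∈ Icc 0 β, |(∫ u, ψ u * fe (s + η - u)) - f s| ≤ ε / 2 := by
    intro s hs
    have hs1 : s + η ∈ Icc 0 γ := ⟨by linarith [hs.1], by linarith [hs.2]⟩
    have hs2 : s ∈ Icc 0 γ := ⟨hs.1, by linarith [hs.2]⟩
    have h1 := φ.dist_normed_convolution_le (μ := MeasureTheory.volume) (g := fe) (x₀ := s + η)
      (ε := ε / 4) hfec.aestronglyMeasurable (fun y hy => by
        have hy' : |y - (s + η)| < η := by simpa [Real.dist_eq] using hy
        rw [abs_lt] at hy'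
        refine (hu y ⟨by linarith [hs.1], by linarith [hs.2]⟩ _ hs1 ?_).le
        rw [Real.dist_eq, abs_lt]
        constructor <;> linarith)
    have h2 := (hu _ hs1 _ hs2 (by rw [Real.dist_eq, abs_lt]; constructor <;> linarith)).le
    rw [hfeq hs2]
    have h3 := (dist_triangle _ _ _).trans (add_le_add h1 h2)
    rw [Real.dist_eq] at h3
    refine le_trans (le_of_eq ?_) (h3.trans (by linarith))
    rfl
  refine ⟨fun s => (∫ u, ψ u * fe (s + η - u)) - ε / 2, hcd.sub contDiff_const, ?_, ?_, ?_⟩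
  · refine MatrixConvexOn.sub_const (MatrixConvexOn.integral (fun u => φ.nonneg_normed u) hint
      fun u hu => ?_) _
    have hu' : u ∈ Function.support (φ.normed MeasureTheory.volume) := hu
    rw [φ.support_normed_eq, Metric.mem_ball, Real.dist_eq, sub_zero] at hu'
    have hu'' : |u| < η := hu'
    rw [abs_lt] at hu''
    have h1 : MatrixConvexOn n (Ico 0 γ) fe :=
      (hconv.mono (Ico_subset_Icc_self.trans hsub)).congr_Ico (hfeq.mono Ico_subset_Icc_self)
    have h2 := (h1.comp_add_const (η - u)).mono (J := Ico 0 β) (fun s hs =>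
      ⟨by linarith [hs.1], by linarith [hs.2]⟩)
    convert h2 using 3
    ring
  · have := (abs_le.1 (happ 0 ⟨le_rfl, hβ.le⟩)).2
    linarith
  · intro s hs
    have := abs_le.1 (happ s hs)
    rw [abs_le]
    constructor <;> linarith

end Approx

/-! ### Noncommutative expansion of powers to second order. -/

section PowExpansion

variable {R : Type*} [Ring R] [Algebra ℝ R]

/-- The coefficient of `s` in `(X + s Y) ^ m`. -/
noncomputable def powCoeffOne (X Y : R) : ℕ → R
  | 0 => 0
  | m + 1 => X * powCoeffOne X Y m + Y * X ^ m

/-- The coefficient of `s ^ 2` in `(X + s Y) ^ m`. -/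
noncomputable def powCoeffTwo (X Y : R) : ℕ → R
  | 0 => 0
  | m + 1 => X * powCoeffTwo X Y m + Y * powCoeffOne X Y m

/-- The quotient by `s ^ 3` of the terms of order at least `3` in `(X + s Y) ^ m`. -/
noncomputable def powRemainder (X Y : R) (s : ℝ) : ℕ → R
  | 0 => 0
  | m + 1 => (X + s • Y) * powRemainder X Y s m + Y * powCoeffTwo X Y m

/-- The remainder is an explicit polynomial in `X`, `Y`, `s`, hence continuous when these depend on
a parameter. -/
lemma add_smul_pow_eq (X Y : R) (s : ℝ) (m : ℕ) :
    (X + s • Y) ^ m = X ^ m + s • powCoeffOne X Y m + s ^ 2 • powCoeffTwo X Y m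
      + s ^ 3 • powRemainder X Y s m := by
  induction m with
  | zero => simp [powCoeffOne, powCoeffTwo, powRemainder]
  | succ m ih =>
    rw [pow_succ', ih]
    simp only [powCoeffOne, powCoeffTwo, powRemainder, add_mul, mul_add, smul_mul_assoc,
      mul_smul_comm, pow_succ' X m]
    module

end PowExpansion

/-! ### Second-order coefficients for arrow perturbations, in terms of moments. -/

section ArrowMatrix

open Matrix

variable {k : ℕ}

/-- The diagonal matrix with entries `0, 1, …, k`. -/
def nodeMatrix (k : ℕ) : Matrix (Fin (k + 1)) (Fin (k + 1)) ℝ :=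
  Matrix.diagonal fun i => (i : ℝ)

/-- The symmetric matrix with first row `(w 0, δ w 1, …, δ w k)` that vanishes outside the first
row and the first column. -/
def arrowMatrix (δ : ℝ) (w : Fin (k + 1) → ℝ) : Matrix (Fin (k + 1)) (Fin (k + 1)) ℝ :=
  Matrix.of (Fin.cons (Fin.cons (w 0) fun j => δ * w j.succ)
    fun i => Fin.cons (δ * w i.succ) fun _ => 0)

/-- The vector `(δ, 1, …, 1)`. -/
def testVector (k : ℕ) (δ : ℝ) : Fin (k + 1) → ℝ := Fin.cons δ fun _ => 1

/-- The `a`-th moment of the weights `w` at the nodes `0, 1, …, k`. -/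
def nodeMoment (w : Fin (k + 1) → ℝ) (a : ℕ) : ℝ := ∑ i, w i * (i : ℝ) ^ a

lemma arrowMatrix_mulVec_zero (δ : ℝ) (w v : Fin (k + 1) → ℝ) :
    (arrowMatrix δ w *ᵥ v) 0 = w 0 * v 0 + δ * ∑ j : Fin k, w j.succ * v j.succ := by
  simp [arrowMatrix, Matrix.mulVec, dotProduct, Fin.sum_univ_succ, Finset.mul_sum, mul_assoc]

lemma arrowMatrix_mulVec_succ (δ : ℝ) (w v : Fin (k + 1) → ℝ) (i : Fin k) :
    (arrowMatrix δ w *ᵥ v) i.succ = δ * w i.succ * v 0 := by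
  simp [arrowMatrix, Matrix.mulVec, dotProduct, Fin.sum_univ_succ]

lemma nodeMatrix_mulVec (v : Fin (k + 1) → ℝ) (i : Fin (k + 1)) :
    (nodeMatrix k *ᵥ v) i = i * v i := by
  simp [nodeMatrix, Matrix.mulVec_diagonal]

lemma nodeMatrix_pow_mulVec (m : ℕ) (v : Fin (k + 1) → ℝ) (i : Fin (k + 1)) :
    (nodeMatrix k ^ m *ᵥ v) i = (i : ℝ) ^ m * v i := by
  simp [nodeMatrix, Matrix.diagonal_pow, Matrix.mulVec_diagonal]

lemma powCoeffOne_mulVec_zero (δ : ℝ) (w : Fin (k + 1) → ℝ) (m : ℕ) :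
    (powCoeffOne (nodeMatrix k) (arrowMatrix δ w) (m + 1) *ᵥ testVector k δ) 0
      = δ * nodeMoment w m := by
  rw [powCoeffOne, Matrix.add_mulVec, Pi.add_apply, ← Matrix.mulVec_mulVec, ← Matrix.mulVec_mulVec,
    nodeMatrix_mulVec, arrowMatrix_mulVec_zero]
  simp only [nodeMatrix_pow_mulVec, testVector, nodeMoment, Fin.sum_univ_succ]
  simp
  ring

lemma powCoeffOne_mulVec_succ (δ : ℝ) (w : Fin (k + 1) → ℝ) (m : ℕ) (i : Fin k) :
    (powCoeffOne (nodeMatrix k) (arrowMatrix δ w) (m + 1) *ᵥ testVector k δ) i.succ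
      = δ ^ 2 * w i.succ * (i.succ : ℝ) ^ m := by
  induction m with
  | zero =>
    simp only [powCoeffOne, Matrix.add_mulVec, Pi.add_apply, mul_zero, pow_zero, mul_one,
      arrowMatrix_mulVec_succ]
    simp [testVector]
    ring
  | succ m ih =>
    rw [powCoeffOne, Matrix.add_mulVec, Pi.add_apply, ← Matrix.mulVec_mulVec,
      ← Matrix.mulVec_mulVec, nodeMatrix_mulVec, arrowMatrix_mulVec_succ, nodeMatrix_pow_mulVec, ih]
    simp
    ring

lemma powCoeffTwo_mulVec_zero (δ : ℝ) (w : Fin (k + 1) → ℝ) (m : ℕ) :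
    (powCoeffTwo (nodeMatrix k) (arrowMatrix δ w) (m + 2) *ᵥ testVector k δ) 0
      = δ * w 0 * nodeMoment w m
        + δ ^ 3 * ∑ j : Fin k, w j.succ ^ 2 * (j.succ : ℝ) ^ m := by
  rw [powCoeffTwo, Matrix.add_mulVec, Pi.add_apply, ← Matrix.mulVec_mulVec, ← Matrix.mulVec_mulVec,
    nodeMatrix_mulVec, arrowMatrix_mulVec_zero, powCoeffOne_mulVec_zero]
  simp only [powCoeffOne_mulVec_succ, Finset.mul_sum]
  have : ∀ j : Fin k, δ * (w j.succ * (δ ^ 2 * w j.succ * ((j.succ : Fin (k + 1)) : ℝ) ^ m))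
      = δ ^ 3 * (w j.succ ^ 2 * ((j.succ : Fin (k + 1)) : ℝ) ^ m) := fun j => by ring
  simp only [this]
  simp
  ring

lemma powCoeffTwo_mulVec_succ (δ : ℝ) (w : Fin (k + 1) → ℝ) (m : ℕ) (i : Fin k) :
    (powCoeffTwo (nodeMatrix k) (arrowMatrix δ w) (m + 2) *ᵥ testVector k δ) i.succ
      = δ ^ 2 * w i.succ * ∑ p ∈ Finset.HasAntidiagonal.antidiagonal m,
          (i.succ : ℝ) ^ p.1 * nodeMoment w p.2 := by
  have hrec : ∀ m, (powCoeffTwo (nodeMatrix k) (arrowMatrix δ w) (m + 2) *ᵥ testVector k δ) i.succ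
      = (i.succ : Fin (k + 1)) *
          (powCoeffTwo (nodeMatrix k) (arrowMatrix δ w) (m + 1) *ᵥ testVector k δ) i.succ
        + δ ^ 2 * w i.succ * nodeMoment w m := by
    intro m
    rw [powCoeffTwo, Matrix.add_mulVec, Pi.add_apply, ← Matrix.mulVec_mulVec,
      ← Matrix.mulVec_mulVec, nodeMatrix_mulVec, arrowMatrix_mulVec_succ, powCoeffOne_mulVec_zero]
    ring
  induction m with
  | zero =>
    rw [hrec]
    simp [powCoeffTwo, powCoeffOne]
  | succ m ih =>
    rw [hrec, ih, Finset.Nat.antidiagonal_succ, Finset.sum_cons, Finset.sum_map]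
    simp only [Function.Embedding.coe_prodMap, Prod.map, Function.Embedding.coeFn_mk,
      Function.Embedding.refl_apply, pow_zero, one_mul, pow_succ']
    simp only [mul_assoc, ← Finset.mul_sum]
    ring

/-- The coefficient is the sum of `X^a Y X^b Y X^c` over `a + b + c = m`, read as paths with two
jumps. Through index `0`, where the node vanishes, only `b = 0` survives. There `v i * Y i 0 = δ * w
i` for every `i`, including `0`, which yields products of moments. Through `j ≥ 1` both ends are
`0`, which yields the `δ ^ 4` term. -/
lemma dotProduct_powCoeffTwo (δ : ℝ) (w : Fin (k + 1) → ℝ) (m : ℕ) :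
    testVector k δ ⬝ᵥ
        (powCoeffTwo (nodeMatrix k) (arrowMatrix δ w) (m + 2) *ᵥ testVector k δ)
      = δ ^ 2 * ∑ p ∈ Finset.HasAntidiagonal.antidiagonal m, nodeMoment w p.1 * nodeMoment w p.2
        + δ ^ 4 * ∑ j : Fin k, w j.succ ^ 2 * (j.succ : ℝ) ^ m := by
  have h1 : ∑ p ∈ Finset.HasAntidiagonal.antidiagonal m, nodeMoment w p.1 * nodeMoment w p.2
      = w 0 * nodeMoment w m + ∑ i : Fin k, w i.succ * ∑ p ∈ Finset.HasAntidiagonal.antidiagonal m,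
          (i.succ : ℝ) ^ p.1 * nodeMoment w p.2 := by
    have h2 : ∀ p : ℕ × ℕ, nodeMoment w p.1 * nodeMoment w p.2
        = w 0 * 0 ^ p.1 * nodeMoment w p.2
          + ∑ i : Fin k, w i.succ * ((i.succ : ℝ) ^ p.1 * nodeMoment w p.2) := by
      intro p
      rw [nodeMoment, Fin.sum_univ_succ, add_mul, Finset.sum_mul]
      simp [mul_assoc]
    simp only [h2, Finset.sum_add_distrib]
    rw [Finset.sum_comm]
    simp only [Finset.mul_sum]
    congr 1
    rw [Finset.sum_eq_single (0, m)]
    · simp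
    · intro p hp hne
      have : p.1 ≠ 0 := fun h => hne (by
        rw [Finset.HasAntidiagonal.mem_antidiagonal] at hp
        ext <;> simp <;> omega)
      simp [this]
    · simp
  rw [dotProduct, Fin.sum_univ_succ, powCoeffTwo_mulVec_zero, h1]
  simp only [powCoeffTwo_mulVec_succ]
  simp only [testVector, Fin.cons_zero, Fin.cons_succ, one_mul]
  simp only [mul_assoc, ← Finset.mul_sum]
  ring

lemma powCoeffTwo_zero_one (X Y : Matrix (Fin (k + 1)) (Fin (k + 1)) ℝ) :
    powCoeffTwo X Y 0 = 0 ∧ powCoeffTwo X Y 1 = 0 := by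
  simp [powCoeffTwo, powCoeffOne]

/-- The nodes are distinct, so the Vandermonde matrix is invertible. The explicit inverse makes the
weights continuous in `y`. -/
lemma exists_nodeMoment_eq (y : Fin (k + 1) → ℝ) :
    ∀ a : Fin (k + 1),
      nodeMoment (((vandermonde fun i : Fin (k + 1) => (i : ℝ))ᵀ)⁻¹ *ᵥ y) a = y a := by
  intro a
  have hdet : IsUnit ((vandermonde fun i : Fin (k + 1) => (i : ℝ))ᵀ).det := by
    rw [det_transpose, isUnit_iff_ne_zero, det_vandermonde_ne_zero_iff]
    intro i j h
    exact Fin.ext (Nat.cast_injective (R := ℝ) h)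
  have h := congrFun (congrArg (fun M => M *ᵥ y) (mul_nonsing_inv _ hdet)) a
  simp only [one_mulVec, ← mulVec_mulVec] at h
  rw [← h, nodeMoment, mulVec, dotProduct]
  exact Finset.sum_congr rfl fun i _ => by simp [vandermonde_apply, mul_comm]

end ArrowMatrix

/-! ### Real matrices as complex matrices. -/

section Complexify

open Matrix

variable {n : ℕ}

/-- A real matrix regarded as a complex matrix. -/
noncomputable def complexify (M : Matrix (Fin n) (Fin n) ℝ) : Matrix (Fin n) (Fin n) ℂ :=
  Complex.ofRealHom.mapMatrix M

lemma complexify_add (M N : Matrix (Fin n) (Fin n) ℝ) :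
    complexify (M + N) = complexify M + complexify N := map_add _ _ _

lemma complexify_smul (r : ℝ) (M : Matrix (Fin n) (Fin n) ℝ) :
    complexify (r • M) = r • complexify M := by
  ext i j; simp [complexify]

lemma complexify_pow (M : Matrix (Fin n) (Fin n) ℝ) (m : ℕ) :
    complexify (M ^ m) = complexify M ^ m := map_pow _ _ _

lemma isHermitian_complexify {M : Matrix (Fin n) (Fin n) ℝ} (hM : M.IsSymm) :
    (complexify M).IsHermitian := by
  ext i j
  simpa [complexify] using hM.apply i j

lemma quadForm_complexify (M : Matrix (Fin n) (Fin n) ℝ) (v : Fin n → ℝ) :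
    quadForm (complexify M) (fun i => (v i : ℂ)) = v ⬝ᵥ (M *ᵥ v) := by
  simp [quadForm, complexify, dotProduct, mulVec]

lemma quadForm_one_ofReal (v : Fin n → ℝ) :
    quadForm 1 (fun i => (v i : ℂ)) = v ⬝ᵥ v := by
  have := quadForm_complexify 1 v
  rwa [complexify, map_one, one_mulVec] at this

lemma quadForm_cfc_sum_add (L : ℕ) (c : ℕ → ℝ) {f r : ℝ → ℝ}
    (hf : ∀ u, f u = ∑ m ∈ Finset.range L, c m * u ^ m + r u)
    {M : Matrix (Fin n) (Fin n) ℝ} (hM : M.IsSymm) (ε : ℝ) (v : Fin n → ℝ) :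
    quadForm (cfc f (ε • complexify M)) (fun i => (v i : ℂ)) =
      ∑ m ∈ Finset.range L, c m * ε ^ m * (v ⬝ᵥ (M ^ m *ᵥ v))
        + quadForm (cfc r (ε • complexify M)) (fun i => (v i : ℂ)) := by
  have hA := isHermitian_real_smul (isHermitian_complexify hM) ε
  have hpow : ∀ m : ℕ, quadForm (cfc (fun u : ℝ => u ^ m) (ε • complexify M))
      (fun i => (v i : ℂ)) = ε ^ m * (v ⬝ᵥ (M ^ m *ᵥ v)) := by
    intro m
    have h1 : cfc (fun u : ℝ => u ^ m) (ε • complexify M) = (ε • complexify M) ^ m :=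
      cfc_pow_id (R := ℝ) _ m hA
    rw [h1, smul_pow, quadForm_smul, ← complexify_pow, quadForm_complexify]
  simp only [mul_assoc, ← hpow, quadForm_cfc _ hA, hf, add_mul, Finset.sum_add_distrib,
    Finset.sum_mul, Finset.mul_sum]
  rw [Finset.sum_comm]

lemma abs_le_of_mem_spectrum {M : Matrix (Fin n) (Fin n) ℝ} {c : ℝ}
    (h : ∀ i j, |M i j| ≤ c) {s : ℝ} (hs : s ∈ spectrum ℝ (complexify M)) : |s| ≤ n * c := by
  let _ := Matrix.linftyOpNormedRing (n := Fin n) (α := ℂ)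
  let _ := Matrix.linftyOpNormedAlgebra (n := Fin n) (R := ℝ) (α := ℂ)
  have hn : 0 < n := by
    rcases Nat.eq_zero_or_pos n with rfl | hn
    · exact absurd hs (by simp [spectrum.of_subsingleton])
    · exact hn
  have : Nonempty (Fin n) := ⟨⟨0, hn⟩⟩
  have : NormOneClass (Matrix (Fin n) (Fin n) ℂ) := Matrix.linfty_opNormOneClass
  have hc : 0 ≤ c := (abs_nonneg _).trans (h ⟨0, hn⟩ ⟨0, hn⟩)
  have h1 : ‖s‖ ≤ ‖complexify M‖ := spectrum.norm_le_norm_of_mem hs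
  refine h1.trans ?_
  rw [Matrix.linfty_opNorm_def]
  have h2 : (Finset.univ : Finset (Fin n)).sup (fun i => ∑ j, ‖complexify M i j‖₊)
      ≤ (⟨n * c, by positivity⟩ : NNReal) := by
    refine Finset.sup_le fun i _ => ?_
    refine NNReal.coe_le_coe.1 ?_
    rw [NNReal.coe_sum]
    change _ ≤ (n : ℝ) * c
    refine (Finset.sum_le_sum fun j _ => (?_ : _ ≤ c)).trans (by simp)
    simpa [complexify] using h i j
  exact_mod_cast h2

end Complexify

/-! ### Second differences of powers. -/

section Hankel

open Matrix

variable {k : ℕ}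

lemma isSymm_nodeMatrix_add_smul_arrowMatrix (s δ : ℝ) (w : Fin (k + 1) → ℝ) :
    (nodeMatrix k + s • arrowMatrix δ w).IsSymm := by
  refine IsSymm.add (isSymm_diagonal _) (IsSymm.smul ?_ s)
  ext i j
  refine Fin.cases ?_ (fun i => ?_) i <;> refine Fin.cases ?_ (fun j => ?_) j <;>
    simp [arrowMatrix]

lemma sum_range_antidiagonal_eq {L n : ℕ} (h : ℕ → ℕ → ℝ) (hL : 2 * n ≤ L + 1)
    (h0 : ∀ a b, n ≤ a ∨ n ≤ b → h a b = 0) :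
    ∑ l ∈ Finset.range L, ∑ p ∈ Finset.HasAntidiagonal.antidiagonal l, h p.1 p.2
      = ∑ a : Fin n, ∑ b : Fin n, h a b := by
  have h1 : ∑ a : Fin n, ∑ b : Fin n, h a b
      = ∑ p ∈ Finset.range n ×ˢ Finset.range n, h p.1 p.2 := by
    rw [Finset.sum_product, Finset.sum_range]
    exact Finset.sum_congr rfl fun a _ => by rw [Finset.sum_range]
  rw [h1, ← Finset.sum_fiberwise_of_maps_to (t := Finset.range L) (g := fun p : ℕ × ℕ => p.1 + p.2)]
  · refine Finset.sum_congr rfl fun l _ => (Finset.sum_subset ?_ ?_).symm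
    · intro p hp
      simpa using (Finset.mem_filter.1 hp).2
    · intro p hp hp'
      apply h0
      by_contra! hcon
      apply hp'
      simp only [Finset.mem_filter, Finset.mem_product, Finset.mem_range]
      exact ⟨⟨hcon.1, hcon.2⟩, by simpa using hp⟩
  · intro p hp
    simp only [Finset.mem_product, Finset.mem_range] at hp ⊢
    omega

lemma continuous_powRemainder {X : ℝ → Matrix (Fin (k + 1)) (Fin (k + 1)) ℝ}
    {Y : ℝ → Matrix (Fin (k + 1)) (Fin (k + 1)) ℝ} {s : ℝ → ℝ} (hX : Continuous X)
    (hY : Continuous Y) (hs : Continuous s) (m : ℕ) :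
    Continuous fun ε => powRemainder (X ε) (Y ε) (s ε) m := by
  have h1 : ∀ m, Continuous fun ε => powCoeffOne (X ε) (Y ε) m := by
    intro m
    induction m with
    | zero => exact continuous_const
    | succ m ih => exact (hX.mul ih).add (hY.mul (hX.pow m))
  have h2 : ∀ m, Continuous fun ε => powCoeffTwo (X ε) (Y ε) m := by
    intro m
    induction m with
    | zero => exact continuous_const
    | succ m ih => exact (hX.mul ih).add (hY.mul (h1 m))
  induction m with
  | zero => exact continuous_const
  | succ m ih => exact ((hX.add (hs.smul hY)).mul ih).add (hY.mul (h2 m))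

lemma dotProduct_pow_second_difference (s δ : ℝ) (w : Fin (k + 1) → ℝ) (m : ℕ) :
    testVector k δ ⬝ᵥ ((nodeMatrix k + s • arrowMatrix δ w) ^ m *ᵥ testVector k δ)
      + testVector k δ ⬝ᵥ ((nodeMatrix k + (-s) • arrowMatrix δ w) ^ m *ᵥ testVector k δ)
      - 2 * (testVector k δ ⬝ᵥ (nodeMatrix k ^ m *ᵥ testVector k δ))
    = 2 * s ^ 2 * (testVector k δ ⬝ᵥ
        (powCoeffTwo (nodeMatrix k) (arrowMatrix δ w) m *ᵥ testVector k δ))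
      + s ^ 3 * (testVector k δ ⬝ᵥ
        (powRemainder (nodeMatrix k) (arrowMatrix δ w) s m *ᵥ testVector k δ)
      - testVector k δ ⬝ᵥ
        (powRemainder (nodeMatrix k) (arrowMatrix δ w) (-s) m *ᵥ testVector k δ)) := by
  rw [add_smul_pow_eq, add_smul_pow_eq]
  simp only [add_mulVec, smul_mulVec, dotProduct_add, dotProduct_smul, smul_eq_mul]
  ring

end Hankel

/-! ### Positivity of the Hankel form of a smooth matrix convex function. -/

section Hankel

open Matrix

variable {k : ℕ}

lemma continuous_arrowMatrix {δ : ℝ → ℝ} {w : ℝ → Fin (k + 1) → ℝ} (hδ : Continuous δ)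
    (hw : Continuous w) : Continuous fun ε => arrowMatrix (δ ε) (w ε) := by
  have hw' := continuous_pi_iff.1 hw
  refine continuous_matrix fun i j => ?_
  refine Fin.cases ?_ (fun i => ?_) i <;> refine Fin.cases ?_ (fun j => ?_) j <;>
    simp only [arrowMatrix, Matrix.of_apply, Fin.cons_zero, Fin.cons_succ]
  · exact hw' 0
  · exact hδ.mul (hw' _)
  · exact hδ.mul (hw' _)
  · exact continuous_const

lemma continuous_testVector {δ : ℝ → ℝ} (hδ : Continuous δ) :
    Continuous fun ε => testVector k (δ ε) := by
  refine continuous_pi fun i => ?_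
  refine Fin.cases ?_ (fun i => ?_) i <;> simp only [testVector, Fin.cons_zero, Fin.cons_succ]
  · exact hδ
  · exact continuous_const

/-- Prescribing the moments `ε ^ (k - a) * x a` for `a ≤ k` gives all terms `ε ^ (a + 1) *
nodeMoment` the common order `ε ^ (k + 1)`. Higher moments carry at least one more factor `ε` and
drop out at `ε = 0`. -/
lemma exists_scaled_nodeMoment (x : Fin (k + 1) → ℝ) :
    ∃ (w : ℝ → Fin (k + 1) → ℝ) (z : ℕ → ℝ → ℝ), Continuous w ∧ (∀ a, Continuous (z a)) ∧
      (∀ a ε, ε ^ (a + 1) * nodeMoment (w ε) a = ε ^ (k + 1) * z a ε) ∧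
      (∀ a : Fin (k + 1), z a 0 = x a) ∧ ∀ a, k + 1 ≤ a → z a 0 = 0 := by
  let w : ℝ → Fin (k + 1) → ℝ := fun ε =>
    ((vandermonde fun i : Fin (k + 1) => (i : ℝ))ᵀ)⁻¹ *ᵥ fun a => ε ^ (k - a : ℕ) * x a
  have hw : Continuous w := Continuous.matrix_mulVec continuous_const
    (continuous_pi fun a => (continuous_id.pow _).mul continuous_const)
  have hw' := continuous_pi_iff.1 hw
  refine ⟨w, fun a ε => if h : a < k + 1 then x ⟨a, h⟩ else ε ^ (a - k) * nodeMoment (w ε) a,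
    hw, fun a => ?_, fun a ε => ?_, fun a => by simp [a.2], fun a ha => ?_⟩
  · by_cases h : a < k + 1
    · simpa [h] using continuous_const
    · simp only [h, dite_false]
      exact (continuous_id.pow _).mul
        (continuous_finsetSum _ fun i _ => (hw' i).mul continuous_const)
  · by_cases h : a < k + 1
    · have h1 := exists_nodeMoment_eq (fun a : Fin (k + 1) => ε ^ (k - a : ℕ) * x a) ⟨a, h⟩
      simp only [h, dite_true]
      rw [show nodeMoment (w ε) a = _ from h1, ← mul_assoc, ← pow_add]
      congr 2
      simp only
      omega
    · simp only [h, dite_false]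
      rw [← mul_assoc, ← pow_add]
      congr 2
      omega
  · have h : ¬ a < k + 1 := by omega
    have h2 : a - k ≠ 0 := by omega
    simp [h, h2]

/-- Matrix curves along which the second difference of all powers isolates the Hankel form. -/
lemma exists_second_difference_expansion (x : Fin (k + 1) → ℝ) (c : ℕ → ℝ) :
    ∃ (N : ℕ) (P Q : ℝ → Matrix (Fin (k + 1)) (Fin (k + 1)) ℝ) (v : ℝ → Fin (k + 1) → ℝ)
      (Ψ : ℝ → ℝ), Continuous P ∧ Continuous Q ∧ Continuous v ∧ Continuous Ψ ∧
      (∀ ε, (P ε).IsSymm) ∧ (∀ ε, (Q ε).IsSymm) ∧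
      Ψ 0 = 2 * ∑ i : Fin (k + 1), ∑ j : Fin (k + 1), x i * x j * c (i + j + 2) ∧
      ∀ ε, ∑ m ∈ Finset.range (N + 1), c m * ε ^ m * (v ε ⬝ᵥ (P ε ^ m *ᵥ v ε)
        + v ε ⬝ᵥ (Q ε ^ m *ᵥ v ε)
        - 2 * (v ε ⬝ᵥ (((1 / 2 : ℝ) • P ε + (1 - 1 / 2 : ℝ) • Q ε) ^ m *ᵥ v ε)))
        = ε ^ N * Ψ ε := by
  obtain ⟨w, z, hw, hz, hwz, hz0, hz1⟩ := exists_scaled_nodeMoment x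
  -- With perturbation size `ε ^ r` and `δ = ε ^ (k + 2)`, the wanted term has order `2 * r + 2 * (k
  -- + 2) + 2 * (k + 1) = N`. The choice of `r` makes the cubic remainder start at `3 * r = N + 1`,
  -- and the `δ ^ 4` term has order at least `N + 4`.
  set r := 4 * k + 7 with hr
  set N := 12 * k + 20 with hN
  let δ : ℝ → ℝ := fun ε => ε ^ (k + 2)
  have hδ : Continuous δ := continuous_pow _
  let v : ℝ → Fin (k + 1) → ℝ := fun ε => testVector k (δ ε)
  have hv : Continuous v := continuous_testVector hδ
  let Y : ℝ → Matrix (Fin (k + 1)) (Fin (k + 1)) ℝ := fun ε => arrowMatrix (δ ε) (w ε)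
  have hY : Continuous Y := continuous_arrowMatrix hδ hw
  have hs : Continuous fun ε : ℝ => ε ^ r := continuous_pow r
  let ρ : ℕ → ℝ → ℝ := fun m ε => v ε ⬝ᵥ (powRemainder (nodeMatrix k) (Y ε) (ε ^ r) m *ᵥ v ε)
      - v ε ⬝ᵥ (powRemainder (nodeMatrix k) (Y ε) (-ε ^ r) m *ᵥ v ε)
  have hρ : ∀ m, Continuous (ρ m) := fun m =>
    (hv.dotProduct ((continuous_powRemainder continuous_const hY hs m).matrix_mulVec hv)).sub
      (hv.dotProduct ((continuous_powRemainder continuous_const hY hs.neg m).matrix_mulVec hv))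
  let q : ℕ → ℝ → ℝ := fun l ε =>
    ∑ p ∈ Finset.HasAntidiagonal.antidiagonal l, z p.1 ε * z p.2 ε
      + ε ^ (l + 4) * ∑ j : Fin k, w ε j.succ ^ 2 * (j.succ : ℝ) ^ l
  have hq : ∀ l, Continuous (q l) := fun l =>
    (continuous_finsetSum _ fun p _ => (hz _).mul (hz _)).add ((continuous_pow _).mul
      (continuous_finsetSum _ fun j _ => (((continuous_pi_iff.1 hw) j.succ).pow 2).mul
        continuous_const))
  refine ⟨N, fun ε => nodeMatrix k + ε ^ r • Y ε, fun ε => nodeMatrix k + (-ε ^ r) • Y ε, v,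
    fun ε => ∑ l ∈ Finset.range (N - 1), c (l + 2) * (2 * q l ε)
      + ∑ m ∈ Finset.range (N + 1), c m * (ε ^ (m + 1) * ρ m ε),
    continuous_const.add (hs.smul hY), continuous_const.add (hs.neg.smul hY), hv,
    (continuous_finsetSum _ fun l _ => continuous_const.mul (continuous_const.mul (hq l))).add
      (continuous_finsetSum _ fun m _ => continuous_const.mul ((continuous_pow _).mul (hρ m))),
    fun ε => isSymm_nodeMatrix_add_smul_arrowMatrix _ _ _,
    fun ε => isSymm_nodeMatrix_add_smul_arrowMatrix _ _ _, ?_, fun ε => ?_⟩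
  · have h1 := sum_range_antidiagonal_eq (L := N - 1) (n := k + 1)
      (fun a b => z a 0 * z b 0 * c (a + b + 2)) (by omega) (by
        rintro a b (h | h)
        · simp [hz1 a h]
        · simp [hz1 b h])
    simp only [hz0] at h1
    rw [← h1, Finset.mul_sum]
    simp only [q, pow_succ, mul_zero, zero_mul, Finset.sum_const_zero, add_zero]
    refine Finset.sum_congr rfl fun l _ => ?_
    rw [mul_left_comm, Finset.mul_sum]
    congr 1
    refine Finset.sum_congr rfl fun p hp => ?_
    rw [Finset.HasAntidiagonal.mem_antidiagonal.1 hp]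
    ring
  · have hX : (1 / 2 : ℝ) • (nodeMatrix k + ε ^ r • Y ε)
        + (1 - 1 / 2 : ℝ) • (nodeMatrix k + (-ε ^ r) • Y ε) = nodeMatrix k := by module
    simp only [hX]
    have h1 : ∀ m, ε ^ m * (v ε ⬝ᵥ ((nodeMatrix k + ε ^ r • Y ε) ^ m *ᵥ v ε)
        + v ε ⬝ᵥ ((nodeMatrix k + (-ε ^ r) • Y ε) ^ m *ᵥ v ε)
        - 2 * (v ε ⬝ᵥ (nodeMatrix k ^ m *ᵥ v ε)))
        = 2 * ε ^ (m + 2 * r) * (v ε ⬝ᵥ (powCoeffTwo (nodeMatrix k) (Y ε) m *ᵥ v ε))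
          + ε ^ N * (ε ^ (m + 1) * ρ m ε) := by
      intro m
      rw [show v ε = testVector k (δ ε) from rfl, show Y ε = arrowMatrix (δ ε) (w ε) from rfl,
        dotProduct_pow_second_difference]
      have : ε ^ N * ε ^ (m + 1) = ε ^ m * (ε ^ r) ^ 3 := by
        rw [← pow_mul, ← pow_add, ← pow_add]; congr 1; omega
      rw [← mul_assoc (ε ^ N), this]
      simp only [ρ, Y, v]
      ring
    have h2 : ∀ l, 2 * ε ^ (l + 2 + 2 * r) *
        (v ε ⬝ᵥ (powCoeffTwo (nodeMatrix k) (Y ε) (l + 2) *ᵥ v ε)) = ε ^ N * (2 * q l ε) := by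
      intro l
      rw [show v ε = testVector k (δ ε) from rfl, show Y ε = arrowMatrix (δ ε) (w ε) from rfl,
        dotProduct_powCoeffTwo]
      have h3 : ε ^ (l + 2) * ∑ p ∈ Finset.HasAntidiagonal.antidiagonal l,
          nodeMoment (w ε) p.1 * nodeMoment (w ε) p.2
          = ε ^ (2 * (k + 1)) * ∑ p ∈ Finset.HasAntidiagonal.antidiagonal l, z p.1 ε * z p.2 ε := by
        rw [Finset.mul_sum, Finset.mul_sum]
        refine Finset.sum_congr rfl fun p hp => ?_
        rw [← Finset.HasAntidiagonal.mem_antidiagonal.1 hp]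
        calc _ = (ε ^ (p.1 + 1) * nodeMoment (w ε) p.1) * (ε ^ (p.2 + 1) * nodeMoment (w ε) p.2) := by
              ring
          _ = _ := by rw [hwz, hwz]; ring
      have h4 : ε ^ (l + 2 + 2 * r) * δ ε ^ 2 = ε ^ (2 * r + 2 * (k + 2)) * ε ^ (l + 2) := by
        simp only [δ]; ring
      have h5 : ε ^ N = ε ^ (2 * r + 2 * (k + 2)) * ε ^ (2 * (k + 1)) := by
        rw [← pow_add]; congr 1; omega
      have h6 : ε ^ (l + 2 + 2 * r) * δ ε ^ 4 = ε ^ N * ε ^ (l + 4) := by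
        simp only [δ]; rw [← pow_mul, ← pow_add, ← pow_add]; congr 1; omega
      calc _ = 2 * ((ε ^ (l + 2 + 2 * r) * δ ε ^ 2) *
            ∑ p ∈ Finset.HasAntidiagonal.antidiagonal l,
              nodeMoment (w ε) p.1 * nodeMoment (w ε) p.2)
            + 2 * ((ε ^ (l + 2 + 2 * r) * δ ε ^ 4) *
              ∑ j : Fin k, w ε j.succ ^ 2 * (j.succ : ℝ) ^ l) := by ring
        _ = _ := by rw [h4, mul_assoc, h3, h6, h5]; simp only [q]; ring
    simp only [mul_assoc (c _), h1, mul_add, Finset.sum_add_distrib]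
    congr 1
    -- Powers `0` and `1` have no second-order coefficient, so the sum is reindexed by `m = l + 2`.
    · rw [show N + 1 = (N - 1) + 1 + 1 by omega, Finset.sum_range_succ', Finset.sum_range_succ']
      simp only [(powCoeffTwo_zero_one (nodeMatrix k) (Y ε)).1, zero_add,
        (powCoeffTwo_zero_one (nodeMatrix k) (Y ε)).2, zero_mulVec, dotProduct_zero, mul_zero,
        add_zero, Finset.mul_sum]
      refine Finset.sum_congr rfl fun l _ => ?_
      rw [mul_left_comm (ε ^ N), ← h2 l]
    · rw [Finset.mul_sum]
      exact Finset.sum_congr rfl fun m _ => by ring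

lemma iteratedDeriv_isLittleO_taylor {F : ℝ → ℝ} (hF : ContDiff ℝ ((⊤ : ℕ∞) : WithTop ℕ∞) F)
    (t : ℝ) (N : ℕ) :
    (fun u => F (u + t) - ∑ m ∈ Finset.range (N + 1),
      iteratedDeriv m F t / (m.factorial : ℝ) * u ^ m) =o[𝓝 0] fun u => u ^ N := by
  have h1 := taylor_isLittleO_univ (x₀ := t) (n := N) (hF.of_le (by exact_mod_cast le_top))
  have h2 : Tendsto (fun u : ℝ => u + t) (𝓝 0) (𝓝 t) := by
    have : Continuous fun u : ℝ => u + t := by fun_prop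
    simpa using this.tendsto 0
  have h3 := h1.comp_tendsto h2
  simp only [Function.comp_def, taylor_within_apply, iteratedDerivWithin_univ, add_sub_cancel_right,
    smul_eq_mul] at h3
  refine h3.congr_left fun u => ?_
  congr 1
  exact Finset.sum_congr rfl fun m _ => by rw [div_eq_inv_mul]; ring

/-- The spectra of `ε • P ε`, `ε • Q ε` and their midpoint have size `O(ε)`, so the Taylor remainder
of degree `N` contributes `o(ε ^ N)`, while the Taylor polynomial contributes exactly `ε ^ N * Ψ ε`.
Dividing by `ε ^ N` leaves `Ψ 0 ≥ 0`. -/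
theorem MatrixConvexOn.hankel_nonneg {F : ℝ → ℝ}
    (hF : ContDiff ℝ ((⊤ : ℕ∞) : WithTop ℕ∞) F) {β : ℝ}
    (hconv : MatrixConvexOn (k + 1) (Ico 0 β) F) {t : ℝ} (ht : t ∈ Ioo 0 β)
    (x : Fin (k + 1) → ℝ) :
    0 ≤ ∑ i : Fin (k + 1), ∑ j : Fin (k + 1), x i * x j *
      (iteratedDeriv (i + j + 2) F t / ((i + j + 2 : ℕ).factorial : ℝ)) := by
  obtain ⟨N, P, Q, v, Ψ, hP, hQ, hv, hΨ, sP, sQ, hΨ0, hΨe⟩ :=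
    exists_second_difference_expansion x fun m => iteratedDeriv m F t / (m.factorial : ℝ)
  suffices h : 0 ≤ Ψ 0 by linarith
  set M : ℝ → Matrix (Fin (k + 1)) (Fin (k + 1)) ℝ :=
    fun ε => (1 / 2 : ℝ) • P ε + (1 - 1 / 2 : ℝ) • Q ε with hMdef
  have hM : Continuous M := (hP.const_smul (1 / 2 : ℝ)).add (hQ.const_smul (1 - 1 / 2 : ℝ))
  have sM : ∀ ε, (M ε).IsSymm := fun ε => ((sP ε).smul _).add ((sQ ε).smul _)
  have hbound : ∀ {B : ℝ → Matrix (Fin (k + 1)) (Fin (k + 1)) ℝ}, Continuous B →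
      ∃ K, 0 < K ∧ ∀ ε ∈ Icc (0 : ℝ) 1, ∀ s ∈ spectrum ℝ (complexify (B ε)), |s| ≤ K := by
    intro B hB
    have hn : Continuous fun ε => ∑ i, ∑ j, |B ε i j| :=
      continuous_finsetSum _ fun i _ => continuous_finsetSum _ fun j _ =>
        (hB.matrix_elem i j).abs
    obtain ⟨C, hC⟩ := (isCompact_Icc (a := (0 : ℝ)) (b := 1)).exists_bound_of_continuousOn
      hn.continuousOn
    refine ⟨|((k + 1 : ℕ) : ℝ) * C| + 1, by positivity, fun ε hε s hs => ?_⟩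
    have := abs_le_of_mem_spectrum (c := C) (fun i j => ?_) hs
    · exact this.trans ((le_abs_self _).trans (by linarith))
    · refine le_trans ?_ ((le_abs_self _).trans (hC ε hε))
      exact (Finset.single_le_sum (f := fun j => |B ε i j|) (fun j _ => abs_nonneg _)
        (Finset.mem_univ j)).trans (Finset.single_le_sum (f := fun i => ∑ j, |B ε i j|)
          (fun i _ => Finset.sum_nonneg fun j _ => abs_nonneg _) (Finset.mem_univ i))
  obtain ⟨KP, hKP, bP⟩ := hbound hP
  obtain ⟨KQ, hKQ, bQ⟩ := hbound hQ
  obtain ⟨KM, hKM, bM⟩ := hbound hM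
  set K := max KP (max KQ KM)
  have hK : 0 < K := lt_max_of_lt_left hKP
  obtain ⟨V, hV⟩ := (isCompact_Icc (a := (0 : ℝ)) (b := 1)).exists_bound_of_continuousOn
    (hv.dotProduct hv).continuousOn
  set r : ℝ → ℝ := fun u => F (u + t) - ∑ m ∈ Finset.range (N + 1),
      iteratedDeriv m F t / (m.factorial : ℝ) * u ^ m with hr
  have hrO : r =o[𝓝 0] fun u => u ^ N := iteratedDeriv_isLittleO_taylor hF t N
  have hspec : ∀ {B : Matrix (Fin (k + 1)) (Fin (k + 1)) ℝ} {ε : ℝ}, 0 < ε →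
      (∀ s ∈ spectrum ℝ (complexify B), |s| ≤ K) →
      ∀ s ∈ spectrum ℝ (ε • complexify B), |s| ≤ ε * K := by
    intro B ε hε hB s hs
    have h1 : ε⁻¹ • s ∈ spectrum ℝ (complexify B) := by
      have h2 := (spectrum.smul_mem_smul_iff (R := ℝ) (r := Units.mk0 ε hε.ne')
        (a := complexify B) (s := ε⁻¹ • s)).1
      apply h2
      simpa [Units.smul_def, hε.ne'] using hs
    have := hB _ h1
    rwa [smul_eq_mul, abs_mul, abs_inv, abs_of_pos hε, inv_mul_le_iff₀ hε] at this
  -- the inequality up to an error of size `κ`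
  have key : ∀ κ > 0, ∀ᶠ ε in 𝓝[>] (0 : ℝ), -(4 * (κ * K ^ N * V)) ≤ Ψ ε := by
    intro κ hκ
    have h1 := hrO.bound hκ
    obtain ⟨ρ, hρ, h2⟩ := Metric.eventually_nhds_iff.1 h1
    -- Below `ρ` the Taylor remainder is controlled; below `t` and `β - t` the spectra translated by
    -- `t` stay in `[0, β)`.
    set ρ' := min (min ρ 1) (min t (β - t)) with hρ'
    have hρ'0 : 0 < ρ' :=
      lt_min (lt_min hρ one_pos) (lt_min ht.1 (by linarith [ht.2]))
    have hρ'1 : ρ' ≤ ρ := (min_le_left _ _).trans (min_le_left _ _)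
    have hρ'3 : ρ' ≤ t := (min_le_right _ _).trans (min_le_left _ _)
    have hρ'4 : ρ' ≤ β - t := (min_le_right _ _).trans (min_le_right _ _)
    have hpos : 0 < min 1 (ρ' / (K + 1)) := lt_min one_pos (by positivity)
    filter_upwards [Ioo_mem_nhdsGT hpos] with ε hε
    have hε0 : 0 < ε := hε.1
    have hεI : ε ∈ Icc (0 : ℝ) 1 := ⟨hε0.le, hε.2.le.trans (min_le_left _ _)⟩
    have hεK : ε * K < ρ' := by
      have := hε.2.trans_le (min_le_right _ _)
      rw [lt_div_iff₀ (by positivity)] at this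
      nlinarith
    have cP : ∀ s ∈ spectrum ℝ (complexify (P ε)), |s| ≤ K := fun s hs =>
      (bP ε hεI s hs).trans (le_max_left _ _)
    have cQ : ∀ s ∈ spectrum ℝ (complexify (Q ε)), |s| ≤ K := fun s hs =>
      (bQ ε hεI s hs).trans ((le_max_left _ _).trans (le_max_right _ _))
    have cM : ∀ s ∈ spectrum ℝ (complexify (M ε)), |s| ≤ K := fun s hs =>
      (bM ε hεI s hs).trans ((le_max_right _ _).trans (le_max_right _ _))
    have hrem : ∀ {B : Matrix (Fin (k + 1)) (Fin (k + 1)) ℝ}, B.IsSymm →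
        (∀ s ∈ spectrum ℝ (complexify B), |s| ≤ K) →
        |quadForm (cfc r (ε • complexify B)) (fun i => (v ε i : ℂ))|
          ≤ ε ^ N * (κ * K ^ N * V) := by
      intro B sB cB
      refine (abs_quadForm_cfc_le (c := κ * (ε * K) ^ N)
        (isHermitian_real_smul (isHermitian_complexify sB) ε) (fun s hs => ?_) _).trans ?_
      · have h3 := hspec hε0 cB s hs
        have h4 := h2 (y := s) (by
          rw [Real.dist_eq, sub_zero]
          exact h3.trans_lt (hεK.trans_le hρ'1))
        rw [Real.norm_eq_abs, Real.norm_eq_abs, abs_pow] at h4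
        exact h4.trans (mul_le_mul_of_nonneg_left (pow_le_pow_left₀ (abs_nonneg _) h3 _) hκ.le)
      · rw [quadForm_one_ofReal]
        have h5 := (le_abs_self _).trans (hV ε hεI)
        calc κ * (ε * K) ^ N * (v ε ⬝ᵥ v ε) ≤ κ * (ε * K) ^ N * V :=
              mul_le_mul_of_nonneg_left h5 (by positivity)
          _ = _ := by rw [mul_pow]; ring
    have hmem : ∀ {B : Matrix (Fin (k + 1)) (Fin (k + 1)) ℝ},
        (∀ s ∈ spectrum ℝ (complexify B), |s| ≤ K) →
        spectrum ℝ (ε • complexify B) ⊆ {s | s + t ∈ Ico 0 β} := by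
      intro B cB s hs
      have h3 := abs_le.1 (hspec hε0 cB s hs)
      exact ⟨by linarith, by linarith⟩
    have h6 := matrixConvexOn_iff_quadForm.1 (hconv.comp_add_const t) (ε • complexify (P ε))
      (ε • complexify (Q ε)) (isHermitian_real_smul (isHermitian_complexify (sP ε)) ε)
      (isHermitian_real_smul (isHermitian_complexify (sQ ε)) ε) (hmem cP) (hmem cQ) (1 / 2)
      (by norm_num) (fun i => (v ε i : ℂ))
    have h7 : (1 / 2 : ℝ) • ε • complexify (P ε) + (1 - 1 / 2 : ℝ) • ε • complexify (Q ε)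
        = ε • complexify (M ε) := by
      rw [hMdef, complexify_add, complexify_smul, complexify_smul]
      module
    have hFr : ∀ u, F (u + t) = ∑ m ∈ Finset.range (N + 1),
        iteratedDeriv m F t / (m.factorial : ℝ) * u ^ m + r u := fun u => by simp [hr]
    rw [h7, quadForm_cfc_sum_add _ _ hFr (sP ε), quadForm_cfc_sum_add _ _ hFr (sQ ε),
      quadForm_cfc_sum_add _ _ hFr (sM ε)] at h6
    have h8 := hΨe ε
    rw [show (1 / 2 : ℝ) • P ε + (1 - 1 / 2 : ℝ) • Q ε = M ε from rfl] at h8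
    simp only [mul_sub, mul_add, Finset.sum_sub_distrib, Finset.sum_add_distrib] at h8
    simp only [mul_left_comm _ (2 : ℝ), ← Finset.mul_sum] at h8
    have eP := abs_le.1 (hrem (sP ε) cP)
    have eQ := abs_le.1 (hrem (sQ ε) cQ)
    have eM := abs_le.1 (hrem (sM ε) cM)
    refine le_of_mul_le_mul_left ?_ (pow_pos hε0 N)
    rw [← h8]
    linarith [eP.2, eQ.2, eM.1]
  have hlim : Tendsto Ψ (𝓝[>] 0) (𝓝 (Ψ 0)) := (hΨ.tendsto 0).mono_left nhdsWithin_le_nhds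
  have h9 : ∀ κ > 0, -(4 * (κ * K ^ N * V)) ≤ Ψ 0 := fun κ hκ => ge_of_tendsto hlim (key κ hκ)
  have h10 : Tendsto (fun κ : ℝ => -(4 * (κ * K ^ N * V))) (𝓝[>] 0) (𝓝 0) := by
    have : Continuous fun κ : ℝ => -(4 * (κ * K ^ N * V)) := by fun_prop
    have := (this.tendsto 0).mono_left (nhdsWithin_le_nhds (s := Ioi 0))
    simpa using this
  exact le_of_tendsto h10 (by filter_upwards [self_mem_nhdsWithin] with κ hκ using h9 κ hκ)

end Hankel

/-! ### Passage from `F` to `F/t`. -/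

section Quotient

/-- The derivatives of `t ↦ F t / t` on `t ≠ 0`, expressed through those of `F`. -/
noncomputable def quotDeriv (F : ℝ → ℝ) : ℕ → ℝ → ℝ
  | 0 => fun t => F t / t
  | l + 1 => fun t => (iteratedDeriv (l + 1) F t - (l + 1) * quotDeriv F l t) / t

variable {F : ℝ → ℝ} (hF : ContDiff ℝ ((⊤ : ℕ∞) : WithTop ℕ∞) F)
include hF

lemma hasDerivAt_iteratedDeriv_of_smooth (l : ℕ) (t : ℝ) :
    HasDerivAt (iteratedDeriv l F) (iteratedDeriv (l + 1) F t) t := by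
  rw [iteratedDeriv_succ]
  exact (hF.differentiable_iteratedDeriv l (by exact_mod_cast ENat.natCast_lt_top l)
    t).hasDerivAt

lemma hasDerivAt_quotDeriv (l : ℕ) {t : ℝ} (ht : t ≠ 0) :
    HasDerivAt (quotDeriv F l) (quotDeriv F (l + 1) t) t := by
  induction l with
  | zero =>
    have h1 := hasDerivAt_iteratedDeriv_of_smooth hF 0 t
    rw [iteratedDeriv_zero] at h1
    refine (h1.fun_div (hasDerivAt_id' t) ht).congr_deriv ?_
    simp only [quotDeriv]
    push_cast
    field_simp
    ring
  | succ l ih =>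
    refine (((hasDerivAt_iteratedDeriv_of_smooth hF (l + 1) t).fun_sub
      (ih.const_mul ((l : ℝ) + 1))).fun_div (hasDerivAt_id' t) ht).congr_deriv ?_
    simp only [quotDeriv]
    push_cast
    field_simp
    ring

/-- With `g = F/t`, Leibniz' rule for `F = t * g` gives `t * g^(l+1) + (l + 1) * g^(l) = F^(l+1)`.
-/
lemma hasDerivAt_pow_mul_quotDeriv (l : ℕ) {t : ℝ} (ht : t ≠ 0) :
    HasDerivAt (fun t => t ^ (l + 1) * quotDeriv F l t) (t ^ l * iteratedDeriv (l + 1) F t) t := by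
  refine ((hasDerivAt_pow (l + 1) t).fun_mul (hasDerivAt_quotDeriv hF l ht)).congr_deriv ?_
  simp only [quotDeriv, Nat.add_sub_cancel]
  push_cast
  field_simp
  ring

lemma tendsto_pow_mul_quotDeriv (l : ℕ) :
    Tendsto (fun t => t ^ (l + 1) * quotDeriv F l t) (𝓝[>] 0)
      (𝓝 ((-1) ^ l * (l.factorial : ℝ) * F 0)) := by
  induction l with
  | zero =>
    have h1 : Tendsto F (𝓝[>] 0) (𝓝 (F 0)) :=
      (hF.continuous.tendsto 0).mono_left nhdsWithin_le_nhds
    simp only [pow_zero, Nat.factorial_zero, Nat.cast_one, one_mul]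
    refine h1.congr' ?_
    filter_upwards [self_mem_nhdsWithin] with t ht
    have : t ≠ 0 := (mem_Ioi.1 ht).ne'
    simp [quotDeriv]
    field_simp
  | succ l ih =>
    have h1 : Tendsto (fun t : ℝ => t ^ (l + 1) * iteratedDeriv (l + 1) F t) (𝓝[>] 0) (𝓝 0) := by
      have h2 : Continuous fun t : ℝ => t ^ (l + 1) * iteratedDeriv (l + 1) F t :=
        (continuous_pow _).mul (hF.continuous_iteratedDeriv (l + 1) (by exact_mod_cast le_top))
      simpa using (h2.tendsto 0).mono_left (nhdsWithin_le_nhds (s := Ioi 0))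
    have h3 := h1.sub (ih.const_mul ((l : ℝ) + 1))
    have h4 : (0 : ℝ) - (l + 1) * ((-1) ^ l * (l.factorial : ℝ) * F 0)
        = (-1) ^ (l + 1) * ((l + 1).factorial : ℝ) * F 0 := by
      rw [Nat.factorial_succ]; push_cast; ring
    rw [h4] at h3
    refine h3.congr' ?_
    filter_upwards [self_mem_nhdsWithin] with t ht
    have : t ≠ 0 := (mem_Ioi.1 ht).ne'
    simp only [quotDeriv]
    field_simp
    ring

omit hF in
-- `1 / (i + j + 2)` is the integral of `u * u ^ i * u ^ j` over `[0, 1]`, so the matrix is a Gram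
-- matrix.
lemma sum_mul_div_add_two_nonneg {n : ℕ} (y : Fin n → ℝ) :
    0 ≤ ∑ i : Fin n, ∑ j : Fin n, y i * y j / ((i : ℝ) + j + 2) := by
  have h1 : ∑ i : Fin n, ∑ j : Fin n, y i * y j / ((i : ℝ) + j + 2)
      = ∫ u in (0 : ℝ)..1, u * (∑ i : Fin n, y i * u ^ (i : ℕ)) ^ 2 := by
    have h2 : ∀ u : ℝ, u * (∑ i : Fin n, y i * u ^ (i : ℕ)) ^ 2
        = ∑ i : Fin n, ∑ j : Fin n, y i * y j * u ^ (i + j + 1 : ℕ) := by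
      intro u
      rw [sq, Finset.sum_mul_sum, Finset.mul_sum]
      refine Finset.sum_congr rfl fun i _ => ?_
      rw [Finset.mul_sum]
      exact Finset.sum_congr rfl fun j _ => by ring
    simp only [h2]
    rw [intervalIntegral.integral_finsetSum fun i _ =>
      (by fun_prop : Continuous _).intervalIntegrable _ _]
    refine Finset.sum_congr rfl fun i _ => ?_
    rw [intervalIntegral.integral_finsetSum fun j _ =>
      (by fun_prop : Continuous _).intervalIntegrable _ _]
    refine Finset.sum_congr rfl fun j _ => ?_
    rw [intervalIntegral.integral_const_mul, integral_pow]
    simp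
    ring
  rw [h1]
  exact intervalIntegral.integral_nonneg zero_le_one fun u hu => mul_nonneg hu.1 (sq_nonneg _)

/-- The rescaled form `Φ y` is nondecreasing, since its derivative at `s` is `s` times the Hankel
form of `F` at the vector `s ^ i * y i`. Its limit at `0⁺` is nonnegative because `F 0 ≤ 0`.
Choosing `y i = x i / t ^ i` undoes the rescaling. -/
theorem quotDeriv_hankel_nonneg {n : ℕ} {β : ℝ} (h0 : F 0 ≤ 0)
    (hH : ∀ t ∈ Ioo 0 β, ∀ x : Fin n → ℝ, 0 ≤ ∑ i : Fin n, ∑ j : Fin n, x i * x j *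
      (iteratedDeriv (i + j + 2) F t / ((i + j + 2 : ℕ).factorial : ℝ)))
    {t : ℝ} (ht : t ∈ Ioo 0 β) (x : Fin n → ℝ) :
    0 ≤ ∑ i : Fin n, ∑ j : Fin n, x i * x j *
      (quotDeriv F (i + j + 1) t / ((i + j + 2 : ℕ).factorial : ℝ)) := by
  let Φ : (Fin n → ℝ) → ℝ → ℝ := fun y s => ∑ i : Fin n, ∑ j : Fin n,
    y i * y j / ((i + j + 2 : ℕ).factorial : ℝ) *
      (s ^ (i + j + 1 + 1 : ℕ) * quotDeriv F (i + j + 1) s)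
  have hder : ∀ y, ∀ s ∈ Ioo 0 β, HasDerivAt (Φ y) (∑ i : Fin n, ∑ j : Fin n,
      y i * y j / ((i + j + 2 : ℕ).factorial : ℝ) *
        (s ^ (i + j + 1 : ℕ) * iteratedDeriv (i + j + 1 + 1) F s)) s := fun y s hs =>
    HasDerivAt.fun_sum fun i _ => HasDerivAt.fun_sum fun j _ =>
      (hasDerivAt_pow_mul_quotDeriv hF (i + j + 1) hs.1.ne').const_mul _
  have hmono : ∀ y, MonotoneOn (Φ y) (Ioo 0 β) := by
    intro y
    refine monotoneOn_of_deriv_nonneg (convex_Ioo 0 β)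
      (fun s hs => (hder y s hs).continuousAt.continuousWithinAt)
      (fun s hs => ((hder y s (interior_subset hs)).differentiableAt).differentiableWithinAt)
      fun s hs => ?_
    have hs := interior_subset hs
    rw [(hder y s hs).deriv]
    have h1 := mul_nonneg hs.1.le (hH s hs fun i => s ^ (i : ℕ) * y i)
    refine h1.trans_eq ?_
    rw [Finset.mul_sum]
    refine Finset.sum_congr rfl fun i _ => ?_
    rw [Finset.mul_sum]
    refine Finset.sum_congr rfl fun j _ => ?_
    ring
  have hlim : ∀ y, Tendsto (Φ y) (𝓝[>] 0) (𝓝 (-F 0 * ∑ i : Fin n, ∑ j : Fin n,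
      ((-1) ^ (i : ℕ) * y i) * ((-1) ^ (j : ℕ) * y j) / ((i : ℝ) + j + 2))) := by
    intro y
    have h1 := tendsto_finsetSum (Finset.univ : Finset (Fin n)) fun i _ =>
      tendsto_finsetSum (Finset.univ : Finset (Fin n)) fun j _ =>
        (tendsto_pow_mul_quotDeriv hF (i + j + 1)).const_mul
          (y i * y j / ((i + j + 2 : ℕ).factorial : ℝ))
    convert h1 using 2
    rw [Finset.mul_sum]
    refine Finset.sum_congr rfl fun i _ => ?_
    rw [Finset.mul_sum]
    refine Finset.sum_congr rfl fun j _ => ?_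
    have h2 : ((i + j + 2 : ℕ).factorial : ℝ)
        = ((i : ℝ) + j + 2) * ((i + j + 1 : ℕ).factorial : ℝ) := by
      rw [show (i + j + 2 : ℕ) = (i + j + 1) + 1 by ring, Nat.factorial_succ]
      push_cast
      ring
    have h3 : ((i + j + 1 : ℕ).factorial : ℝ) ≠ 0 := by positivity
    have h4 : (i : ℝ) + j + 2 ≠ 0 := by positivity
    rw [h2]
    field_simp
    ring
  have hΦ : ∀ y, 0 ≤ Φ y t := by
    intro y
    refine (mul_nonneg (neg_nonneg.2 h0) (sum_mul_div_add_two_nonneg _)).trans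
      (le_of_tendsto (hlim y) ?_)
    filter_upwards [Ioo_mem_nhdsGT ht.1] with s hs
    exact hmono y ⟨hs.1, hs.2.trans ht.2⟩ ht hs.2.le
  have h5 := mul_nonneg (sq_nonneg t⁻¹) (hΦ fun i => (t ^ (i : ℕ))⁻¹ * x i)
  refine h5.trans_eq ?_
  have ht0 := ht.1.ne'
  simp only [Φ]
  rw [Finset.mul_sum]
  refine Finset.sum_congr rfl fun i _ => ?_
  rw [Finset.mul_sum]
  refine Finset.sum_congr rfl fun j _ => ?_
  field_simp
  ring

end Quotient

/-! ### Pairing the Hankel form with a test polynomial. -/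

section TestFunction

open Polynomial

/-- A polynomial that is positive on `(1, 2)` and vanishes to order `m` at `1` and at `2`. -/
noncomputable def testPoly (m : ℕ) : ℝ[X] := (X - C 1) ^ m * (X - C 2) ^ m

lemma testPoly_iterate_derivative_eval {m l : ℕ} (h : l < m) :
    (derivative^[l] (testPoly m)).eval 1 = 0 ∧ (derivative^[l] (testPoly m)).eval 2 = 0 := by
  have h0 : testPoly m ≠ 0 := mul_ne_zero (pow_ne_zero _ (X_sub_C_ne_zero _))
    (pow_ne_zero _ (X_sub_C_ne_zero _))
  constructor
  · exact isRoot_iterate_derivative_of_lt_rootMultiplicity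
      (h.trans_le ((le_rootMultiplicity_iff h0).2 (dvd_mul_right _ _)))
  · exact isRoot_iterate_derivative_of_lt_rootMultiplicity
      (h.trans_le ((le_rootMultiplicity_iff h0).2 (dvd_mul_left _ _)))

lemma testPoly_eval_nonneg (n : ℕ) (u : ℝ) : 0 ≤ (testPoly (2 * n)).eval u := by
  simp only [testPoly, pow_mul, eval_mul, eval_pow]
  positivity

lemma integral_testPoly_pos (n : ℕ) : 0 < ∫ u in (1 : ℝ)..2, (testPoly (2 * n)).eval u := by
  refine intervalIntegral.intervalIntegral_pos_of_pos_on
    ((testPoly (2 * n)).continuous.intervalIntegrable _ _) (fun u hu => ?_) one_lt_two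
  refine lt_of_le_of_ne (testPoly_eval_nonneg n u) (Ne.symm ?_)
  simp only [testPoly, eval_mul, eval_pow, eval_sub, eval_X, eval_C]
  exact mul_ne_zero (pow_ne_zero _ (sub_ne_zero.2 hu.1.ne')) (pow_ne_zero _ (sub_ne_zero.2 hu.2.ne))

/-- Repeated integration by parts. The sequence `a` lists successive derivatives, and each
differentiation in `u` produces a factor `ε`. -/
lemma integral_iterate_derivative_mul {t ε : ℝ} (l : ℕ) (a : ℕ → ℝ → ℝ) (W : ℝ[X])
    (ha : ∀ m, ∀ u ∈ Icc (1 : ℝ) 2, HasDerivAt (a m) (a (m + 1) (t + ε * u)) (t + ε * u))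
    (hW : ∀ m < l, (derivative^[m] W).eval 1 = 0 ∧ (derivative^[m] W).eval 2 = 0) :
    ε ^ l * ∫ u in (1 : ℝ)..2, a l (t + ε * u) * W.eval u
      = (-1) ^ l * ∫ u in (1 : ℝ)..2, a 0 (t + ε * u) * (derivative^[l] W).eval u := by
  induction l generalizing W with
  | zero => simp
  | succ l ih =>
    have hcomp : ∀ m, ∀ u ∈ uIcc (1 : ℝ) 2,
        HasDerivAt (fun u => a m (t + ε * u)) (a (m + 1) (t + ε * u) * ε) u := by
      intro m u hu
      rw [uIcc_of_le one_le_two] at hu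
      refine (ha m u hu).comp u ?_
      simpa using ((hasDerivAt_id' u).const_mul ε).const_add t
    have hcont : ∀ m, ContinuousOn (fun u => a m (t + ε * u)) (uIcc (1 : ℝ) 2) := fun m u hu =>
      (hcomp m u hu).continuousAt.continuousWithinAt
    have h1 := intervalIntegral.integral_mul_deriv_eq_deriv_mul (a := (1 : ℝ)) (b := 2)
      (u := fun u => W.eval u) (u' := fun u => (derivative W).eval u)
      (v := fun u => a l (t + ε * u)) (v' := fun u => a (l + 1) (t + ε * u) * ε)
      (fun u _ => W.hasDerivAt u) (hcomp l)
      ((derivative W).continuous.intervalIntegrable _ _)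
      (((hcont (l + 1)).mul continuousOn_const).intervalIntegrable)
    have h2 := hW 0 (Nat.succ_pos l)
    simp only [Function.iterate_zero, id] at h2
    rw [h2.1, h2.2] at h1
    have h3 := ih (derivative W) fun m hm => by
      have := hW (m + 1) (by omega)
      rwa [Function.iterate_succ_apply] at this
    rw [Function.iterate_succ_apply, pow_succ (-1 : ℝ), mul_assoc, neg_one_mul, mul_neg, ← h3]
    have h4 : ∫ u in (1 : ℝ)..2, W.eval u * (a (l + 1) (t + ε * u) * ε)
        = ε * ∫ u in (1 : ℝ)..2, a (l + 1) (t + ε * u) * W.eval u := by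
      rw [← intervalIntegral.integral_const_mul]
      exact intervalIntegral.integral_congr fun u _ => by ring
    have h5 : ∫ u in (1 : ℝ)..2, (derivative W).eval u * a l (t + ε * u)
        = ∫ u in (1 : ℝ)..2, a l (t + ε * u) * (derivative W).eval u :=
      intervalIntegral.integral_congr fun u _ => by ring
    rw [h4, h5] at h1
    rw [pow_succ, mul_assoc, h1]
    ring

/-- The kernel obtained by letting the adjoint of the differential operator of the Hankel form
act on the test polynomial at scale `ε`. -/
noncomputable def hankelKernel {n : ℕ} (x : Fin n → ℝ) (ε u : ℝ) : ℝ :=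
  ∑ i : Fin n, ∑ j : Fin n, x i * x j / ((i + j + 2 : ℕ).factorial : ℝ) *
    ((-1) ^ (i + j + 1 : ℕ) * (ε⁻¹) ^ (i + j + 1 : ℕ) *
      (derivative^[i + j + 1] (testPoly (2 * n))).eval u)

lemma continuous_hankelKernel {n : ℕ} (x : Fin n → ℝ) (ε : ℝ) :
    Continuous (hankelKernel x ε) :=
  continuous_finsetSum _ fun _ _ => continuous_finsetSum _ fun _ _ =>
    continuous_const.mul (continuous_const.mul (Polynomial.continuous _))

lemma integral_mul_hankelKernel {n : ℕ} (x : Fin n → ℝ) {t ε : ℝ} (hε : ε ≠ 0) (a : ℕ → ℝ → ℝ)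
    (ha : ∀ m, ∀ u ∈ Icc (1 : ℝ) 2, HasDerivAt (a m) (a (m + 1) (t + ε * u)) (t + ε * u)) :
    ∫ u in (1 : ℝ)..2, a 0 (t + ε * u) * hankelKernel x ε u
      = ∫ u in (1 : ℝ)..2, (∑ i : Fin n, ∑ j : Fin n, x i * x j *
        (a (i + j + 1) (t + ε * u) / ((i + j + 2 : ℕ).factorial : ℝ))) *
          (testPoly (2 * n)).eval u := by
  have hcont : ∀ m, ContinuousOn (fun u => a m (t + ε * u)) (uIcc (1 : ℝ) 2) := by
    intro m u hu
    rw [uIcc_of_le one_le_two] at hu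
    exact ((ha m u hu).continuousAt.comp (f := fun u => t + ε * u)
      (by fun_prop)).continuousWithinAt
  simp only [hankelKernel, Finset.mul_sum, Finset.sum_mul]
  rw [intervalIntegral.integral_finsetSum, intervalIntegral.integral_finsetSum]
  · refine Finset.sum_congr rfl fun i _ => ?_
    rw [intervalIntegral.integral_finsetSum, intervalIntegral.integral_finsetSum]
    · refine Finset.sum_congr rfl fun j _ => ?_
      -- Since `i + j + 1 ≤ 2 * n - 1`, vanishing to order `2 * n` at both endpoints removes every
      -- boundary term.
      have h1 := integral_iterate_derivative_mul (t := t) (ε := ε) (i + j + 1) a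
        (testPoly (2 * n)) ha fun m hm => testPoly_iterate_derivative_eval (by omega)
      have h2 : ∫ u in (1 : ℝ)..2, a (i + j + 1) (t + ε * u) * (testPoly (2 * n)).eval u
          = (ε⁻¹) ^ (i + j + 1 : ℕ) * ((-1) ^ (i + j + 1 : ℕ) * ∫ u in (1 : ℝ)..2,
            a 0 (t + ε * u) * (derivative^[i + j + 1] (testPoly (2 * n))).eval u) := by
        rw [← h1, ← mul_assoc, ← mul_pow, inv_mul_cancel₀ hε, one_pow, one_mul]
      calc _ = x i * x j / ((i + j + 2 : ℕ).factorial : ℝ) *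
            ((ε⁻¹) ^ (i + j + 1 : ℕ) * ((-1) ^ (i + j + 1 : ℕ) * ∫ u in (1 : ℝ)..2,
            a 0 (t + ε * u) * (derivative^[i + j + 1] (testPoly (2 * n))).eval u)) := by
            rw [← mul_assoc, ← mul_assoc, ← intervalIntegral.integral_const_mul]
            exact intervalIntegral.integral_congr fun u _ => by ring
        _ = _ := by
            rw [← h2, ← intervalIntegral.integral_const_mul]
            exact intervalIntegral.integral_congr fun u _ => by ring
    · exact fun j _ => ContinuousOn.intervalIntegrable (((continuousOn_const.mul
        ((hcont _).div_const _))).mul (Polynomial.continuous _).continuousOn)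
    · exact fun j _ => ContinuousOn.intervalIntegrable ((hcont 0).mul (continuousOn_const.mul
        (continuousOn_const.mul (Polynomial.continuous _).continuousOn)))
  · exact fun i _ => ContinuousOn.intervalIntegrable (continuousOn_finsetSum _ fun j _ =>
      (((continuousOn_const.mul ((hcont _).div_const _))).mul
        (Polynomial.continuous _).continuousOn))
  · exact fun i _ => ContinuousOn.intervalIntegrable (continuousOn_finsetSum _ fun j _ =>
      ((hcont 0).mul (continuousOn_const.mul
        (continuousOn_const.mul (Polynomial.continuous _).continuousOn))))

end TestFunction

/-! ### The integrated inequality for merely continuous `f`. -/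

section Distributional

variable {n : ℕ} {α : ℝ} {f : ℝ → ℝ}

theorem MatrixConvexOn.exists_quotDeriv_approx (hn : 1 ≤ n) (hcont : ContinuousOn f (Ico 0 α))
    (hconv : MatrixConvexOn n (Ico 0 α) f) (h0 : f 0 ≤ 0) {β : ℝ} (hβ : 0 < β) (hβα : β < α)
    {κ : ℝ} (hκ : 0 < κ) :
    ∃ F : ℝ → ℝ, ContDiff ℝ ((⊤ : ℕ∞) : WithTop ℕ∞) F ∧ (∀ s ∈ Icc 0 β, |F s - f s| ≤ κ) ∧
      ∀ t ∈ Ioo 0 β, ∀ x : Fin n → ℝ, 0 ≤ ∑ i : Fin n, ∑ j : Fin n, x i * x j *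
        (quotDeriv F (i + j + 1) t / ((i + j + 2 : ℕ).factorial : ℝ)) := by
  obtain ⟨F, hF, hFc, hF0, hFf⟩ := hconv.exists_smooth_approx hcont h0 hβ hβα hκ
  obtain ⟨k, rfl⟩ : ∃ k, n = k + 1 := ⟨n - 1, by omega⟩
  exact ⟨F, hF, hFf, fun t ht x =>
    quotDeriv_hankel_nonneg hF hF0 (fun s hs y => hFc.hankel_nonneg hF hs y) ht x⟩

/-- For the smooth approximants this is the Hankel inequality integrated against a nonnegative
polynomial. No derivatives are left on `F`, and `t + ε * u ≥ ε`, so an error `κ` in `F` costs at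
most `κ / ε * C`. -/
theorem MatrixConvexOn.integral_hankelKernel_nonneg (hn : 1 ≤ n)
    (hcont : ContinuousOn f (Ico 0 α)) (hconv : MatrixConvexOn n (Ico 0 α) f) (h0 : f 0 ≤ 0)
    (x : Fin n → ℝ) {t ε : ℝ} (ht : 0 ≤ t) (hε : 0 < ε) (htε : t + 2 * ε < α) :
    0 ≤ ∫ u in (1 : ℝ)..2, f (t + ε * u) / (t + ε * u) * hankelKernel x ε u := by
  obtain ⟨β, hβ1, hβ2⟩ := exists_between htε
  have hβ0 : 0 < β := by linarith
  have hmem : ∀ u ∈ Icc (1 : ℝ) 2, t + ε * u ∈ Ioo 0 β ∧ ε ≤ t + ε * u := by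
    intro u hu
    have h1 : ε * 1 ≤ ε * u := mul_le_mul_of_nonneg_left hu.1 hε.le
    have h2 : ε * u ≤ ε * 2 := mul_le_mul_of_nonneg_left hu.2 hε.le
    exact ⟨⟨by linarith, by linarith⟩, by linarith⟩
  obtain ⟨C, hC⟩ := (isCompact_Icc (a := (1 : ℝ)) (b := 2)).exists_bound_of_continuousOn
    (continuous_hankelKernel x ε).continuousOn
  have hgc : ContinuousOn (fun u => f (t + ε * u) / (t + ε * u)) (uIcc (1 : ℝ) 2) := by
    rw [uIcc_of_le one_le_two]
    refine ContinuousOn.div (hcont.comp (by fun_prop) fun u hu => ?_) (by fun_prop)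
      fun u hu => (hmem u hu).1.1.ne'
    exact ⟨(hmem u hu).1.1.le, (hmem u hu).1.2.trans hβ2⟩
  have key : ∀ κ > 0, -(κ / ε * C) ≤
      ∫ u in (1 : ℝ)..2, f (t + ε * u) / (t + ε * u) * hankelKernel x ε u := by
    intro κ hκ
    obtain ⟨F, hF, hFf, hFh⟩ := hconv.exists_quotDeriv_approx hn hcont h0 hβ0 hβ2 hκ
    have h1 := integral_mul_hankelKernel x hε.ne' (quotDeriv F)
      (fun m u hu => hasDerivAt_quotDeriv hF m (hmem u hu).1.1.ne')
    have h2 : 0 ≤ ∫ u in (1 : ℝ)..2, quotDeriv F 0 (t + ε * u) * hankelKernel x ε u := by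
      rw [h1]
      exact intervalIntegral.integral_nonneg one_le_two fun u hu =>
        mul_nonneg (hFh _ (hmem u hu).1 x) (testPoly_eval_nonneg n u)
    have hFc : ContinuousOn (fun u => quotDeriv F 0 (t + ε * u)) (uIcc (1 : ℝ) 2) := by
      rw [uIcc_of_le one_le_two]
      exact ContinuousOn.div ((hF.continuous.comp (by fun_prop)).continuousOn) (by fun_prop)
        fun u hu => (hmem u hu).1.1.ne'
    have h3 : ‖∫ u in (1 : ℝ)..2, (quotDeriv F 0 (t + ε * u) * hankelKernel x ε u
        - f (t + ε * u) / (t + ε * u) * hankelKernel x ε u)‖ ≤ κ / ε * C * |(2 : ℝ) - 1| := by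
      refine intervalIntegral.norm_integral_le_of_norm_le_const fun u hu => ?_
      rw [uIoc_of_le one_le_two] at hu
      have hu' := hmem u (Ioc_subset_Icc_self hu)
      rw [← sub_mul, norm_mul]
      refine mul_le_mul ?_ (hC u (Ioc_subset_Icc_self hu)) (norm_nonneg _) (by positivity)
      rw [quotDeriv, ← sub_div, Real.norm_eq_abs, abs_div, abs_of_pos hu'.1.1]
      exact div_le_div₀ hκ.le (hFf _ (Ioo_subset_Icc_self hu'.1)) hε hu'.2
    have i1 : IntervalIntegrable (fun u => quotDeriv F 0 (t + ε * u) * hankelKernel x ε u)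
        MeasureTheory.volume 1 2 :=
      (hFc.mul (continuous_hankelKernel x ε).continuousOn).intervalIntegrable
    have i2 : IntervalIntegrable (fun u => f (t + ε * u) / (t + ε * u) * hankelKernel x ε u)
        MeasureTheory.volume 1 2 :=
      (hgc.mul (continuous_hankelKernel x ε).continuousOn).intervalIntegrable
    rw [intervalIntegral.integral_sub i1 i2] at h3
    have h4 := (abs_le.1 h3).2
    norm_num at h4
    linarith
  have h10 : Tendsto (fun κ : ℝ => -(κ / ε * C)) (𝓝[>] 0) (𝓝 0) := by
    have : Continuous fun κ : ℝ => -(κ / ε * C) := by fun_prop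
    simpa using (this.tendsto 0).mono_left (nhdsWithin_le_nhds (s := Ioi 0))
  exact le_of_tendsto h10 (by filter_upwards [self_mem_nhdsWithin] with κ hκ using key κ hκ)

end Distributional

/-! ### One-sided Taylor expansion with Peano remainder. -/

section Peano

lemma TimesDifferentiableWithinAt.pred_derivWithin {m : ℕ} {G : ℝ → ℝ} {S : Set ℝ} {t : ℝ}
    (h : TimesDifferentiableWithinAt (m + 1) G S t) :
    TimesDifferentiableWithinAt m (derivWithin G S) S t := by
  intro k hk
  have := h (k + 1) (by omega)
  simp only [iteratedDerivWithin_succ'] at this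
  exact ⟨this.1, fun hk' => this.2 (by omega)⟩

/-- Taylor's theorem with Peano remainder, on the right of `t`. -/
lemma TimesDifferentiableWithinAt.isLittleO_taylor {a b : ℝ} {m : ℕ} {G : ℝ → ℝ} {t : ℝ}
    (h : TimesDifferentiableWithinAt (m + 1) G (Ico a b) t) (ht : t ∈ Ico a b) :
    (fun s => G s - ∑ l ∈ Finset.range (m + 2),
      iteratedDerivWithin l G (Ico a b) t / (l.factorial : ℝ) * (s - t) ^ l)
        =o[𝓝[>] t] fun s => (s - t) ^ (m + 1) := by
  have hle : 𝓝[>] t ≤ 𝓝[Ico a b] t := by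
    rw [← nhdsWithin_Ioo_eq_nhdsGT ht.2]
    exact nhdsWithin_mono _ fun s hs => ⟨ht.1.trans hs.1.le, hs.2⟩
  induction m generalizing G with
  | zero =>
    have h1 := (h 0 (by omega)).1
    rw [iteratedDerivWithin_zero] at h1
    have h2 := (hasDerivWithinAt_iff_isLittleO.1 h1.hasDerivWithinAt).mono hle
    refine (h2.congr_left fun s => ?_).trans_eventuallyEq (.of_eq (by ext; simp))
    simp [Finset.sum_range_succ, iteratedDerivWithin_one]
    ring
  | succ m ih =>
    have h1 := ih h.pred_derivWithin
    set S := Ico a b with hS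
    set E : ℝ → ℝ := fun s => G s - ∑ l ∈ Finset.range (m + 1 + 2),
      iteratedDerivWithin l G S t / (l.factorial : ℝ) * (s - t) ^ l with hE
    set E' : ℝ → ℝ := fun s => derivWithin G S s - ∑ l ∈ Finset.range (m + 2),
      iteratedDerivWithin l (derivWithin G S) S t / (l.factorial : ℝ) * (s - t) ^ l with hE'
    have hder : ∀ s, DifferentiableWithinAt ℝ G S s → HasDerivWithinAt E (E' s) S s := by
      intro s hs
      refine hs.hasDerivWithinAt.sub ?_
      have h2 : HasDerivAt (fun s => ∑ l ∈ Finset.range (m + 1 + 2),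
          iteratedDerivWithin l G S t / (l.factorial : ℝ) * (s - t) ^ l)
          (∑ l ∈ Finset.range (m + 1 + 2), iteratedDerivWithin l G S t / (l.factorial : ℝ) *
            ((l : ℝ) * (s - t) ^ (l - 1) * 1)) s :=
        HasDerivAt.fun_sum fun l _ => (((hasDerivAt_id' s).sub_const t).fun_pow l).const_mul _
      refine (h2.congr_deriv ?_).hasDerivWithinAt
      rw [Finset.sum_range_succ']
      simp only [Nat.cast_zero, zero_mul, mul_zero, add_zero]
      refine Finset.sum_congr rfl fun l _ => ?_
      rw [iteratedDerivWithin_succ', Nat.factorial_succ]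
      push_cast
      field_simp
    have hEt : E t = 0 := by
      rw [hE]
      simp only [sub_self]
      rw [Finset.sum_range_succ']
      simp
    have hE't : E' t = 0 := by
      rw [hE']
      simp only [sub_self]
      rw [Finset.sum_range_succ']
      simp
    rw [Asymptotics.isLittleO_iff]
    intro κ hκ
    have h3 := h1.bound hκ
    have h4 := hle ((h 0 (by omega)).2 (by omega))
    rw [iteratedDerivWithin_zero] at h4
    have h5 : ∀ᶠ s in 𝓝[>] t, (‖E' s‖ ≤ κ * ‖(s - t) ^ (m + 1)‖ ∧
        DifferentiableWithinAt ℝ G S s) ∧ s < b :=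
      (h3.and h4).and (by filter_upwards [Ioo_mem_nhdsGT ht.2] with s hs using hs.2)
    obtain ⟨ρ, hρ, h6⟩ := mem_nhdsGT_iff_exists_Ioo_subset.1 h5
    filter_upwards [Ioo_mem_nhdsGT hρ] with s hs
    have hIS : Icc t s ⊆ S := fun y hy =>
      ⟨ht.1.trans hy.1, hy.2.trans_lt (h6 hs).2⟩
    have ht0 : DifferentiableWithinAt ℝ G S t := by
      have := (h 0 (by omega)).1
      rwa [iteratedDerivWithin_zero] at this
    -- The induction hypothesis for the derivative bounds `E'` on `[t, s]` by `κ * (s - t) ^ (m +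
    -- 1)`; the mean value inequality adds the missing factor `s - t`.
    have h7 := (convex_Icc t s).norm_image_sub_le_of_norm_hasDerivWithin_le (f := E) (f' := E')
      (C := κ * (s - t) ^ (m + 1)) (x := t) (y := s) (fun y hy => ?_) (fun y hy => ?_)
      ⟨le_rfl, hs.1.le⟩ ⟨hs.1.le, le_rfl⟩
    · rw [hEt, sub_zero] at h7
      refine h7.trans (le_of_eq ?_)
      rw [Real.norm_eq_abs, Real.norm_eq_abs, abs_pow, abs_of_pos (sub_pos.2 hs.1)]
      ring
    · refine (hder y ?_).mono hIS
      rcases hy.1.eq_or_lt with rfl | hy1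
      · exact ht0
      · exact (h6 ⟨hy1, hy.2.trans_lt hs.2⟩).1.2
    · rcases hy.1.eq_or_lt with rfl | hy1
      · rw [hE't, norm_zero]
        exact mul_nonneg hκ.le (pow_nonneg (sub_nonneg.2 hs.1.le) _)
      · refine (h6 ⟨hy1, hy.2.trans_lt hs.2⟩).1.1.trans ?_
        rw [Real.norm_eq_abs, abs_pow, abs_of_pos (sub_pos.2 hy1)]
        exact mul_le_mul_of_nonneg_left (pow_le_pow_left₀ (sub_nonneg.2 hy.1)
          (sub_le_sub_right hy.2 t) _) hκ.le

end Peano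

/-! ### Recovering the pointwise Hankel inequality. -/

section HankelLimit

open Polynomial

variable {n : ℕ} {α : ℝ} {f : ℝ → ℝ}

/-- The worst power of `ε⁻¹` in the kernel is `2 * n - 1`, exactly the order to which the Peano
remainder of the quotient is small. -/
lemma exists_hankelKernel_bound (x : Fin n → ℝ) : ∃ C, 0 ≤ C ∧ ∀ ε ∈ Ioc (0 : ℝ) 1,
    ∀ u ∈ Icc (1 : ℝ) 2, |hankelKernel x ε u| * ε ^ (2 * n - 1) ≤ C := by
  have hb : ∀ l : ℕ, ∃ C, 0 ≤ C ∧
      ∀ u ∈ Icc (1 : ℝ) 2, |(derivative^[l] (testPoly (2 * n))).eval u| ≤ C := by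
    intro l
    obtain ⟨C, hC⟩ := (isCompact_Icc (a := (1 : ℝ)) (b := 2)).exists_bound_of_continuousOn
      (derivative^[l] (testPoly (2 * n))).continuous.continuousOn
    exact ⟨C, (norm_nonneg _).trans (hC 1 (by norm_num)), hC⟩
  choose C hC0 hC using hb
  refine ⟨∑ i : Fin n, ∑ j : Fin n, |x i * x j / ((i + j + 2 : ℕ).factorial : ℝ)| *
    C (i + j + 1), Finset.sum_nonneg fun i _ => Finset.sum_nonneg fun j _ =>
      mul_nonneg (abs_nonneg _) (hC0 _), fun ε hε u hu => ?_⟩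
  have hpos : 0 ≤ ε ^ (2 * n - 1) := pow_nonneg hε.1.le _
  rw [hankelKernel]
  refine (mul_le_mul_of_nonneg_right (Finset.abs_sum_le_sum_abs _ _) hpos).trans ?_
  rw [Finset.sum_mul]
  refine Finset.sum_le_sum fun i _ => ?_
  refine (mul_le_mul_of_nonneg_right (Finset.abs_sum_le_sum_abs _ _) hpos).trans ?_
  rw [Finset.sum_mul]
  refine Finset.sum_le_sum fun j _ => ?_
  rw [abs_mul, mul_assoc]
  refine mul_le_mul_of_nonneg_left ?_ (abs_nonneg _)
  rw [abs_mul, abs_mul, abs_pow, abs_neg, abs_one, one_pow, one_mul, abs_pow, abs_inv,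
    abs_of_pos hε.1, mul_right_comm]
  have h1 : ε⁻¹ ^ (i + j + 1 : ℕ) * ε ^ (2 * n - 1) ≤ 1 := by
    rw [inv_pow, inv_mul_le_iff₀ (pow_pos hε.1 _), mul_one]
    exact pow_le_pow_of_le_one hε.1.le hε.2 (by omega)
  exact (mul_le_mul h1 (hC _ u hu) (abs_nonneg _) zero_le_one).trans_eq (one_mul _)

/-- Replacing the quotient by its Taylor polynomial `T` changes the kernel integral by `o(1)`. For
`T` the integration by parts can be undone, giving `Λ ε`, and `Λ 0` is the Hankel form times the
positive integral of the test polynomial. -/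
theorem MatrixConvexOn.antideriv_hankel_nonneg (hn : 1 ≤ n)
    (hcont : ContinuousOn f (Ico 0 α)) (hconv : MatrixConvexOn n (Ico 0 α) f) (h0 : f 0 ≤ 0)
    {G : ℝ → ℝ} (hG : ∀ t ∈ Ioo 0 α, HasDerivAt G (f t / t) t) {t : ℝ} (ht : t ∈ Ico 0 α)
    (hd : TimesDifferentiableWithinAt (2 * n) G (Ico 0 α) t) (x : Fin n → ℝ) :
    0 ≤ ∑ i : Fin n, ∑ j : Fin n, x i * x j *
      (iteratedDerivWithin (i + j + 2) G (Ico 0 α) t / ((i + j + 2 : ℕ).factorial : ℝ)) := by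
  set S := Ico 0 α with hS
  set d : ℕ → ℝ := fun l => iteratedDerivWithin (l + 1) G S t with hdd
  let T : ℝ[X] := ∑ l ∈ Finset.range (2 * n), C (d l / (l.factorial : ℝ)) * X ^ l
  have hTe : ∀ s, T.eval s = ∑ l ∈ Finset.range (2 * n), d l / (l.factorial : ℝ) * s ^ l := by
    intro s
    simp [T, eval_finsetSum]
  have hTd : ∀ l < 2 * n, (derivative^[l] T).eval 0 = d l := by
    intro l hl
    rw [← coeff_zero_eq_eval_zero, coeff_iterate_derivative, zero_add, Nat.descFactorial_self]
    simp only [T, finsetSum_coeff, coeff_C_mul_X_pow]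
    rw [Finset.sum_ite_eq, if_pos (Finset.mem_range.2 hl)]
    rw [nsmul_eq_mul]
    field_simp
  -- the remainder of the quotient
  have hrem : (fun s => f s / s - T.eval (s - t)) =o[𝓝[>] t] fun s => (s - t) ^ (2 * n - 1) := by
    -- The quotient equals `derivWithin G S` to the right of `t`, which has one order of
    -- differentiability less than `G`.
    obtain ⟨m, hm⟩ : ∃ m, 2 * n = m + 2 := ⟨2 * n - 2, by omega⟩
    have h1 : TimesDifferentiableWithinAt (m + 1) (derivWithin G S) S t := by
      rw [hm] at hd
      exact hd.pred_derivWithin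
    have h2 := h1.isLittleO_taylor ht
    rw [show 2 * n - 1 = m + 1 by omega]
    refine h2.congr' ?_ EventuallyEq.rfl
    filter_upwards [Ioo_mem_nhdsGT ht.2] with s hs
    have hs0 : s ∈ Ioo 0 α := ⟨ht.1.trans_lt hs.1, hs.2⟩
    have h3 : derivWithin G S s = f s / s :=
      (hG s hs0).hasDerivWithinAt.derivWithin (uniqueDiffOn_Ico 0 α s ⟨hs0.1.le, hs0.2⟩)
    rw [h3, hTe, hm]
    simp only [hdd, iteratedDerivWithin_succ']
    rfl
  obtain ⟨B, hB0, hB⟩ := exists_hankelKernel_bound x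
  let Λ : ℝ → ℝ := fun ε => ∫ u in (1 : ℝ)..2, (∑ i : Fin n, ∑ j : Fin n, x i * x j *
    ((derivative^[i + j + 1] T).eval (ε * u) / ((i + j + 2 : ℕ).factorial : ℝ))) *
      (testPoly (2 * n)).eval u
  have hΛ : Continuous Λ := by
    refine intervalIntegral.continuous_parametric_intervalIntegral_of_continuous' ?_ 1 2
    simp only [Function.uncurry_def]
    refine Continuous.mul (continuous_finsetSum _ fun i _ => continuous_finsetSum _ fun j _ =>
      continuous_const.mul (Continuous.div_const ?_ _))
        ((Polynomial.continuous _).comp continuous_snd)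
    exact (Polynomial.continuous _).comp (continuous_fst.mul continuous_snd)
  have hΛ0 : Λ 0 = (∑ i : Fin n, ∑ j : Fin n, x i * x j *
      (iteratedDerivWithin (i + j + 2) G S t / ((i + j + 2 : ℕ).factorial : ℝ))) *
        ∫ u in (1 : ℝ)..2, (testPoly (2 * n)).eval u := by
    simp only [Λ, zero_mul]
    rw [intervalIntegral.integral_const_mul]
    congr 1
    refine Finset.sum_congr rfl fun i _ => Finset.sum_congr rfl fun j _ => ?_
    rw [hTd _ (by omega)]
  have key : ∀ κ > 0, ∀ᶠ ε in 𝓝[>] (0 : ℝ), -(κ * 2 ^ (2 * n - 1) * B) ≤ Λ ε := by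
    intro κ hκ
    obtain ⟨ρ, hρ, h6⟩ := mem_nhdsGT_iff_exists_Ioo_subset.1 (hrem.bound hκ)
    have hρ' : 0 < min 1 (min ((ρ - t) / 2) ((α - t) / 2)) :=
      lt_min one_pos (lt_min (half_pos (sub_pos.2 hρ)) (half_pos (sub_pos.2 ht.2)))
    filter_upwards [Ioo_mem_nhdsGT hρ'] with ε hε
    have hε0 : 0 < ε := hε.1
    have hε1 : ε ≤ 1 := hε.2.le.trans (min_le_left _ _)
    have hερ : ε < (ρ - t) / 2 := hε.2.trans_le ((min_le_right _ _).trans (min_le_left _ _))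
    have hεα : ε < (α - t) / 2 := hε.2.trans_le ((min_le_right _ _).trans (min_le_right _ _))
    have h7 := hconv.integral_hankelKernel_nonneg hn hcont h0 x ht.1 hε0 (by linarith)
    have h8 := integral_mul_hankelKernel x (t := 0) hε0.ne' (fun m s => (derivative^[m] T).eval s)
      (fun m u _ => by
        simp only [Function.iterate_succ_apply']
        exact Polynomial.hasDerivAt _ _)
    simp only [zero_add, Function.iterate_zero, id] at h8
    have hmem : ∀ u ∈ Icc (1 : ℝ) 2, ε ≤ ε * u ∧ ε * u ≤ 2 * ε := fun u hu =>
      ⟨by nlinarith [hu.1], by nlinarith [hu.2]⟩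
    have h9 : ‖∫ u in (1 : ℝ)..2, (f (t + ε * u) / (t + ε * u) * hankelKernel x ε u
        - T.eval (ε * u) * hankelKernel x ε u)‖ ≤ κ * 2 ^ (2 * n - 1) * B * |(2 : ℝ) - 1| := by
      refine intervalIntegral.norm_integral_le_of_norm_le_const fun u hu => ?_
      rw [uIoc_of_le one_le_two] at hu
      have hu1 := Ioc_subset_Icc_self hu
      obtain ⟨hu2, hu3⟩ := hmem u hu1
      have h10 : ‖f (t + ε * u) / (t + ε * u) - T.eval (t + ε * u - t)‖
          ≤ κ * ‖(t + ε * u - t) ^ (2 * n - 1)‖ := h6 ⟨by linarith, by linarith⟩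
      rw [add_sub_cancel_left, norm_pow, Real.norm_eq_abs (ε * u),
        abs_of_pos (hε0.trans_le hu2)] at h10
      rw [← sub_mul, norm_mul]
      calc _ ≤ κ * (2 * ε) ^ (2 * n - 1) * ‖hankelKernel x ε u‖ := by
            refine mul_le_mul_of_nonneg_right (h10.trans ?_) (norm_nonneg _)
            exact mul_le_mul_of_nonneg_left
              (pow_le_pow_left₀ (hε0.le.trans hu2) hu3 _) hκ.le
        _ = κ * 2 ^ (2 * n - 1) * (|hankelKernel x ε u| * ε ^ (2 * n - 1)) := by
            rw [mul_pow, Real.norm_eq_abs]; ring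
        _ ≤ _ := mul_le_mul_of_nonneg_left (hB ε ⟨hε0, hε1⟩ u hu1) (by positivity)
    have i1 : IntervalIntegrable (fun u => f (t + ε * u) / (t + ε * u) * hankelKernel x ε u)
        MeasureTheory.volume 1 2 := by
      refine ContinuousOn.intervalIntegrable (ContinuousOn.mul ?_
        (continuous_hankelKernel x ε).continuousOn)
      rw [uIcc_of_le one_le_two]
      refine ContinuousOn.div (hcont.comp (by fun_prop) fun u hu => ?_) (by fun_prop)
        fun u hu => ?_
      · have := hmem u hu
        exact ⟨by linarith [ht.1], by linarith⟩
      · have := hmem u hu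
        have ht1 := ht.1
        exact (by linarith : 0 < t + ε * u).ne'
    have i2 : IntervalIntegrable (fun u => T.eval (ε * u) * hankelKernel x ε u)
        MeasureTheory.volume 1 2 :=
      Continuous.intervalIntegrable ((T.continuous.comp (by fun_prop)).mul
        (continuous_hankelKernel x ε)) _ _
    rw [intervalIntegral.integral_sub i1 i2, h8, show |(2 : ℝ) - 1| = 1 by norm_num, mul_one] at h9
    have h11 := (abs_le.1 h9).2
    simp only [Λ]
    linarith
  have h12 : 0 ≤ Λ 0 := by
    have hlim : Tendsto Λ (𝓝[>] 0) (𝓝 (Λ 0)) := (hΛ.tendsto 0).mono_left nhdsWithin_le_nhds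
    have h13 : Tendsto (fun κ : ℝ => -(κ * 2 ^ (2 * n - 1) * B)) (𝓝[>] 0) (𝓝 0) := by
      have : Continuous fun κ : ℝ => -(κ * 2 ^ (2 * n - 1) * B) := by fun_prop
      simpa using (this.tendsto 0).mono_left (nhdsWithin_le_nhds (s := Ioi 0))
    refine le_of_tendsto h13 ?_
    filter_upwards [self_mem_nhdsWithin] with κ hκ using ge_of_tendsto hlim (key κ hκ)
  rw [hΛ0] at h12
  exact nonneg_of_mul_nonneg_left h12 (integral_testPoly_pos n)

theorem MatrixConvexOn.hankelK_posSemidef (hn : 1 ≤ n)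
    (hcont : ContinuousOn f (Ico 0 α)) (hconv : MatrixConvexOn n (Ico 0 α) f) (h0 : f 0 ≤ 0)
    {G : ℝ → ℝ} (hG : ∀ t ∈ Ioo 0 α, HasDerivAt G (f t / t) t) {t : ℝ} (ht : t ∈ Ico 0 α)
    (hd : TimesDifferentiableWithinAt (2 * n) G (Ico 0 α) t) :
    (hankelK n G (Ico 0 α) t).PosSemidef := by
  rw [Matrix.posSemidef_iff_dotProduct_mulVec]
  refine ⟨?_, fun x => ?_⟩
  · ext i j
    simp [hankelK, add_comm]
  · refine (hconv.antideriv_hankel_nonneg hn hcont h0 hG ht hd x).trans_eq ?_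
    simp only [dotProduct, Matrix.mulVec, hankelK, Matrix.of_apply, Finset.mul_sum, star_trivial]
    refine Finset.sum_congr rfl fun i _ => Finset.sum_congr rfl fun j _ => ?_
    rw [show (i + 1 + (j + 1) : ℕ) = i + j + 2 by ring]
    ring

end HankelLimit

/-! ### The class `Q_2`. -/

section OrderTwo

variable {α : ℝ} {f : ℝ → ℝ}

/-- Scalar matrices reduce to the scalar inequality. It later supplies the right derivatives of `f`.
-/
lemma MatrixConvexOn.convexOn {n : ℕ} (hn : 1 ≤ n) {I : Set ℝ} (hI : Convex ℝ I)
    (h : MatrixConvexOn n I f) : ConvexOn ℝ I f := by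
  have : Nonempty (Fin n) := ⟨⟨0, hn⟩⟩
  refine ⟨hI, fun x hx y hy a b ha hb hab => ?_⟩
  obtain rfl : b = 1 - a := by linarith
  have hherm : ∀ r : ℝ, (algebraMap ℝ (Matrix (Fin n) (Fin n) ℂ) r).IsHermitian := fun r =>
    IsSelfAdjoint.algebraMap (Matrix (Fin n) (Fin n) ℂ) (IsSelfAdjoint.all r)
  have hcfc : ∀ r : ℝ, cfc f (algebraMap ℝ (Matrix (Fin n) (Fin n) ℂ) r)
      = algebraMap ℝ _ (f r) := fun r => cfc_algebraMap r f
  have hq : ∀ r : ℝ, quadForm (algebraMap ℝ (Matrix (Fin n) (Fin n) ℂ) r) 1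
      = r * quadForm 1 (1 : Fin n → ℂ) := fun r => by
    rw [Algebra.algebraMap_eq_smul_one, quadForm_smul]
  have hspec : ∀ r ∈ I, spectrum ℝ (algebraMap ℝ (Matrix (Fin n) (Fin n) ℂ) r) ⊆ I := by
    intro r hr
    rw [spectrum.scalar_eq]
    simpa using hr
  have h1 := matrixConvexOn_iff_quadForm.1 h _ _ (hherm x) (hherm y) (hspec x hx) (hspec y hy) a
    ⟨ha, by linarith⟩ 1
  have h2 : a • algebraMap ℝ (Matrix (Fin n) (Fin n) ℂ) x
      + (1 - a) • algebraMap ℝ (Matrix (Fin n) (Fin n) ℂ) y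
      = algebraMap ℝ _ (a • x + (1 - a) • y) := by
    simp only [Algebra.algebraMap_eq_smul_one, smul_eq_mul]
    module
  rw [h2, hcfc, hcfc, hcfc, hq, hq, hq] at h1
  have h3 : 0 < quadForm 1 (1 : Fin n → ℂ) := quadForm_one_pos one_ne_zero
  refine le_of_mul_le_mul_right ?_ h3
  simp only [smul_eq_mul] at h1 ⊢
  linarith

/-- A nonnegative third derivative makes the second one monotone, so increments of the first are
monotone. This formulation contains no derivatives and is stable under pointwise limits. -/
lemma convexOn_sub_of_quotDeriv_nonneg {F : ℝ → ℝ}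
    (hF : ContDiff ℝ ((⊤ : ℕ∞) : WithTop ℕ∞) F) {β h : ℝ} (hh : 0 < h)
    (h3 : ∀ t ∈ Ioo 0 β, 0 ≤ quotDeriv F 3 t) :
    ConvexOn ℝ (Ioo 0 (β - h)) fun s => F (s + h) / (s + h) - F s / s := by
  have hd : ∀ l, ∀ s ∈ Ioo 0 (β - h), HasDerivAt
      (fun s => quotDeriv F l (s + h) - quotDeriv F l s)
      (quotDeriv F (l + 1) (s + h) - quotDeriv F (l + 1) s) s := by
    intro l s hs
    have h1 := hasDerivAt_quotDeriv hF l (t := s + h) (by linarith [hs.1] : 0 < s + h).ne'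
    exact (h1.comp_add_const s h).sub (hasDerivAt_quotDeriv hF l hs.1.ne')
  have hmono : MonotoneOn (quotDeriv F 2) (Ioo 0 β) :=
    monotoneOn_of_deriv_nonneg (convex_Ioo 0 β)
      (fun s hs => (hasDerivAt_quotDeriv hF 2 hs.1.ne').continuousAt.continuousWithinAt)
      (fun s hs => (hasDerivAt_quotDeriv hF 2
        (interior_subset hs).1.ne').differentiableAt.differentiableWithinAt)
      fun s hs => by
        rw [(hasDerivAt_quotDeriv hF 2 (interior_subset hs).1.ne').deriv]
        exact h3 s (interior_subset hs)
  have hmono1 : MonotoneOn (fun s => quotDeriv F 1 (s + h) - quotDeriv F 1 s) (Ioo 0 (β - h)) :=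
    monotoneOn_of_deriv_nonneg (convex_Ioo 0 _)
      (fun s hs => (hd 1 s hs).continuousAt.continuousWithinAt)
      (fun s hs => (hd 1 s (interior_subset hs)).differentiableAt.differentiableWithinAt)
      fun s hs => by
        have hs := interior_subset hs
        rw [(hd 1 s hs).deriv, sub_nonneg]
        exact hmono ⟨hs.1, by linarith [hs.2]⟩ ⟨by linarith [hs.1], by linarith [hs.2]⟩
          (by linarith)
  refine MonotoneOn.convexOn_of_deriv (f := fun s => quotDeriv F 0 (s + h) - quotDeriv F 0 s)
    (convex_Ioo 0 _) (fun s hs => (hd 0 s hs).continuousAt.continuousWithinAt)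
    (fun s hs => (hd 0 s (interior_subset hs)).differentiableAt.differentiableWithinAt) ?_
  rw [interior_Ioo]
  exact hmono1.congr fun s hs => ((hd 0 s hs).deriv).symm

lemma MatrixConvexOn.convexOn_quotient_sub (hcont : ContinuousOn f (Ico 0 α))
    (hconv : MatrixConvexOn 2 (Ico 0 α) f) (h0 : f 0 ≤ 0) {h : ℝ} (hh : 0 < h) :
    ConvexOn ℝ (Ioo 0 (α - h)) fun s => f (s + h) / (s + h) - f s / s := by
  refine ⟨convex_Ioo _ _, fun x hx y hy a b ha hb hab => ?_⟩
  have hz := convex_Ioo 0 (α - h) hx hy ha hb hab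
  obtain ⟨β, hβ1, hβ2⟩ := exists_between (max_lt (lt_sub_iff_add_lt.1 hx.2)
    (lt_sub_iff_add_lt.1 hy.2))
  have hxβ : x ∈ Ioo 0 (β - h) := ⟨hx.1, lt_sub_iff_add_lt.2 ((le_max_left _ _).trans_lt hβ1)⟩
  have hyβ : y ∈ Ioo 0 (β - h) := ⟨hy.1, lt_sub_iff_add_lt.2 ((le_max_right _ _).trans_lt hβ1)⟩
  have hzβ := convex_Ioo 0 (β - h) hxβ hyβ ha hb hab
  have hβ0 : 0 < β := by linarith [hxβ.1, hxβ.2]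
  choose F hF hFf hFh using fun k : ℕ => hconv.exists_quotDeriv_approx one_le_two hcont h0 hβ0 hβ2
    (Nat.one_div_pos_of_nat (α := ℝ) (n := k))
  have hlim : ∀ s ∈ Icc 0 β, Tendsto (fun k => F k s / s) atTop (𝓝 (f s / s)) := by
    intro s hs
    refine Tendsto.div_const ?_ s
    rw [tendsto_iff_norm_sub_tendsto_zero]
    exact squeeze_zero (fun k => norm_nonneg _) (fun k => hFf k s hs)
      tendsto_one_div_add_atTop_nhds_zero_nat
  have hlim' : ∀ s ∈ Ioo 0 (β - h), Tendsto (fun k => F k (s + h) / (s + h) - F k s / s) atTop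
      (𝓝 (f (s + h) / (s + h) - f s / s)) := fun s hs =>
    (hlim _ ⟨by linarith [hs.1], by linarith [hs.2]⟩).sub
      (hlim _ ⟨hs.1.le, by linarith [hs.2]⟩)
  refine le_of_tendsto_of_tendsto' (hlim' _ hzβ)
    (((hlim' x hxβ).const_smul a).add ((hlim' y hyβ).const_smul b)) fun k => ?_
  refine (convexOn_sub_of_quotDeriv_nonneg (hF k) hh fun t ht => ?_).2 hxβ hyβ ha hb hab
  -- This vector isolates the entry `i = j = 1`, namely `quotDeriv (F k) 3 t / 4!`.
  have h1 := hFh k t ht ![0, 1]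
  simp only [Fin.sum_univ_two, Matrix.cons_val_zero, Matrix.cons_val_one, zero_mul, mul_zero,
    zero_add, one_mul, Fin.val_one] at h1
  have h2 : (0 : ℝ) < ((1 + 1 + 2 : ℕ).factorial : ℝ) := by positivity
  rwa [le_div_iff₀ h2, zero_mul] at h1

/-- The upper Hermite–Hadamard inequality: the graph lies below its chord. -/
lemma trapezoid_of_convexOn {r : ℝ → ℝ} {I : Set ℝ} (hr : ConvexOn ℝ I r)
    (hrc : ContinuousOn r I) {p q : ℝ} (hp : p ∈ I) (hq : q ∈ I) (hpq : p < q) :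
    ∫ s in p..q, r s ≤ (q - p) * ((r p + r q) / 2) := by
  have hsub : Icc p q ⊆ I := hr.1.ordConnected.out hp hq
  have hd : ∀ s, HasDerivAt (fun s => r p * s + (r q - r p) / (q - p) * ((s - p) ^ 2 / 2))
      (r p + (r q - r p) / (q - p) * (s - p)) s := by
    intro s
    have h1 := ((hasDerivAt_id' s).const_mul (r p)).fun_add
      (((((hasDerivAt_id' s).sub_const p).fun_pow 2).div_const 2).const_mul
        ((r q - r p) / (q - p)))
    refine h1.congr_deriv ?_
    push_cast
    ring
  have hne : q - p ≠ 0 := (sub_pos.2 hpq).ne'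
  have h2 : ∫ s in p..q, (r p + (r q - r p) / (q - p) * (s - p))
      = (q - p) * ((r p + r q) / 2) := by
    rw [intervalIntegral.integral_eq_sub_of_hasDerivAt (fun s _ => hd s)
      ((by fun_prop : Continuous _).intervalIntegrable _ _)]
    field_simp
    ring
  rw [← h2]
  refine intervalIntegral.integral_mono_on hpq.le
    ((hrc.mono (by rwa [uIcc_of_le hpq.le])).intervalIntegrable)
    ((by fun_prop : Continuous _).intervalIntegrable _ _) fun s hs => ?_
  have h3 := hr.2 hp hq
    (div_nonneg (sub_nonneg.2 hs.2) (sub_pos.2 hpq).le)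
    (div_nonneg (sub_nonneg.2 hs.1) (sub_pos.2 hpq).le) (by field_simp; ring)
  simp only [smul_eq_mul] at h3
  have h4 : (q - s) / (q - p) * p + (s - p) / (q - p) * q = s := by field_simp; ring
  rw [h4] at h3
  refine h3.trans_eq ?_
  field_simp
  ring

/-- On `x 1 = -x 0` the form is `(M 0 0 + M 1 1 - 2 * M 0 1) * |x 0| ^ 2`. -/
lemma condPosDef_of_two {M : Matrix (Fin 2) (Fin 2) ℝ} (hM : M.IsSymm)
    (h : 0 ≤ M 0 0 + M 1 1 - 2 * M 0 1) : CondPosDef (complexify M) := by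
  refine ⟨isHermitian_complexify hM, fun x hx => ?_⟩
  rw [Fin.sum_univ_two] at hx
  have h1 : x 1 = -x 0 := by linear_combination hx
  have h2 : M 1 0 = M 0 1 := hM.apply 0 1
  simp only [dotProduct, Matrix.mulVec, Fin.sum_univ_two, Pi.star_apply, h1, complexify,
    RingHom.mapMatrix_apply, Matrix.map_apply, Complex.ofRealHom_eq_coe, h2]
  have h3 : (star (x 0) * ((M 0 0 : ℂ) * x 0 + (M 0 1 : ℂ) * -x 0)
      + star (-x 0) * ((M 0 1 : ℂ) * x 0 + (M 1 1 : ℂ) * -x 0))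
      = (((M 0 0 + M 1 1 - 2 * M 0 1) * Complex.normSq (x 0) : ℝ) : ℂ) := by
    push_cast
    rw [Complex.normSq_eq_conj_mul_self, star_neg, ← starRingEnd_apply]
    ring
  rw [h3, Complex.ofReal_re]
  exact mul_nonneg h (Complex.normSq_nonneg _)

theorem MatrixConvexOn.quotient_mem_classQ_two (hcont : ContinuousOn f (Ico 0 α))
    (hconv : MatrixConvexOn 2 (Ico 0 α) f) (h0 : f 0 ≤ 0) :
    (fun t => f t / t) ∈ ClassQ 2 0 α := by
  set g : ℝ → ℝ := fun t => f t / t with hg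
  have hfc : ConvexOn ℝ (Ico 0 α) f := hconv.convexOn one_le_two (convex_Ico 0 α)
  have hgc : ContinuousOn g (Ioo 0 α) := (hcont.mono Ioo_subset_Ico_self).div continuousOn_id
    fun s hs => hs.1.ne'
  obtain ⟨r, hr⟩ : ∃ r : ℝ → ℝ, ∀ s ∈ Ioo 0 α, HasDerivWithinAt g (r s) (Ioi s) s := by
    refine ⟨fun s => (derivWithin f (Ioi s) s * s - f s * 1) / s ^ 2, fun s hs => ?_⟩
    exact (hfc.hasDerivWithinAt_rightDeriv_of_mem_interior (by rwa [interior_Ico])).div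
      (hasDerivWithinAt_id s _) hs.1.ne'
  -- `r` is the pointwise limit of the convex quotients `h⁻¹ * (g (s + h) - g s)`.
  have hrconv : ConvexOn ℝ (Ioo 0 α) r := by
    refine ⟨convex_Ioo _ _, fun x hx y hy a b ha hb hab => ?_⟩
    have hz := convex_Ioo 0 α hx hy ha hb hab
    have hl : ∀ s ∈ Ioo 0 α, Tendsto (fun h => h⁻¹ * (g (s + h) - g s)) (𝓝[>] 0) (𝓝 (r s)) := by
      intro s hs
      have h1 := (hasDerivWithinAt_iff_tendsto_slope' self_notMem_Ioi).1 (hr s hs)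
      have h2 : Tendsto (fun h => s + h) (𝓝[>] 0) (𝓝[>] s) := by
        refine tendsto_nhdsWithin_iff.2 ⟨?_, ?_⟩
        · have : Continuous fun h : ℝ => s + h := by fun_prop
          simpa using (this.tendsto 0).mono_left (nhdsWithin_le_nhds (s := Ioi 0))
        · filter_upwards [self_mem_nhdsWithin] with h hh
          simpa using hh
      refine (h1.comp h2).congr fun h => ?_
      simp [slope_def_field, div_eq_inv_mul]
    refine le_of_tendsto_of_tendsto (hl _ hz)
      (((hl x hx).const_smul a).add ((hl y hy).const_smul b)) ?_
    have hpos : 0 < min (α - x) (α - y) := lt_min (sub_pos.2 hx.2) (sub_pos.2 hy.2)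
    filter_upwards [Ioo_mem_nhdsGT hpos] with h hh
    have h1 := (hconv.convexOn_quotient_sub hcont h0 hh.1).2
      (⟨hx.1, by linarith [hh.2.trans_le (min_le_left _ _)]⟩ : x ∈ Ioo 0 (α - h))
      (⟨hy.1, by linarith [hh.2.trans_le (min_le_right _ _)]⟩ : y ∈ Ioo 0 (α - h)) ha hb hab
    have h2 := mul_le_mul_of_nonneg_left h1 (inv_nonneg.2 hh.1.le)
    simp only [smul_eq_mul, g] at h2 ⊢
    linarith
  have hrc : ContinuousOn r (Ioo 0 α) := hrconv.continuousOn isOpen_Ioo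
  have hint : ∀ p ∈ Ioo 0 α, ∀ q ∈ Ioo 0 α, ∫ s in p..q, r s = g q - g p := by
    intro p hp q hq
    have hsub : uIcc p q ⊆ Ioo 0 α := (convex_Ioo 0 α).ordConnected.uIcc_subset hp hq
    exact intervalIntegral.integral_eq_sub_of_hasDeriv_right (hgc.mono hsub)
      (fun s hs => hr s (hsub (Ioo_subset_Icc_self hs))) (hrc.mono hsub).intervalIntegrable
  -- Since `r` is continuous and `g` is its integral, the right derivative becomes two-sided.
  have hder : ∀ s ∈ Ioo 0 α, HasDerivAt g (r s) s := by
    intro s hs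
    have h1 := intervalIntegral.integral_hasDerivAt_right (f := r) (a := s) (b := s)
      IntervalIntegrable.refl (hrc.stronglyMeasurableAtFilter isOpen_Ioo s hs)
      (hrc.continuousAt (Ioo_mem_nhds hs.1 hs.2))
    refine (h1.const_add (g s)).congr_of_eventuallyEq ?_
    filter_upwards [Ioo_mem_nhds hs.1 hs.2] with q hq
    rw [hint s hs q hq]
    ring
  refine ⟨?_, fun p hp => ?_⟩
  · rw [show (1 : WithTop ℕ∞) = 0 + 1 by simp, contDiffOn_succ_iff_deriv_of_isOpen isOpen_Ioo]
    refine ⟨fun s hs => (hder s hs).differentiableAt.differentiableWithinAt, by simp, ?_⟩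
    rw [contDiffOn_zero]
    exact hrc.congr fun s hs => (hder s hs).deriv
  · have hsymm : ∀ s t : ℝ, dslope g s t = dslope g t s := by
      intro s t
      rcases eq_or_ne s t with rfl | hst
      · rfl
      · rw [dslope_of_ne _ hst.symm, dslope_of_ne _ hst, slope_comm]
    have htrap : ∀ s ∈ Ioo 0 α, ∀ t ∈ Ioo 0 α, s < t →
        0 ≤ dslope g s s + dslope g t t - 2 * dslope g s t := by
      intro s hs t ht hst
      rw [dslope_same, dslope_same, (hder s hs).deriv, (hder t ht).deriv,
        dslope_of_ne _ hst.ne', slope_def_field]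
      have h1 := trapezoid_of_convexOn hrconv hrc hs ht hst
      rw [hint s hs t ht] at h1
      have h2 : (g t - g s) / (t - s) ≤ (r s + r t) / 2 := by
        rw [div_le_iff₀ (sub_pos.2 hst)]
        linarith
      linarith
    have hM : loewnerMatrix g p = complexify (Matrix.of fun i j => dslope g (p i) (p j)) := by
      ext i j
      simp [loewnerMatrix, complexify]
    rw [hM]
    refine condPosDef_of_two (Matrix.IsSymm.ext fun i j => hsymm _ _) ?_
    simp only [Matrix.of_apply]
    rcases lt_trichotomy (p 0) (p 1) with h | h | h
    · exact htrap _ (hp 0) _ (hp 1) h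
    · rw [h]; linarith
    · have := htrap _ (hp 1) _ (hp 0) h
      rw [hsymm (p 0) (p 1)]
      linarith

end OrderTwo

theorem mainTheorem4 (n : ℕ) (hn : 1 ≤ n) (α : ℝ) (hα : 0 < α) (f : ℝ → ℝ)
    (hcont : ContinuousOn f (Ico 0 α)) (hconv : MatrixConvexOn n (Ico 0 α) f) (h0 : f 0 ≤ 0) :
    (∀ G : ℝ → ℝ, (∀ t ∈ Ioo 0 α, HasDerivAt G (f t / t) t) →
      ∀ t ∈ Ico 0 α, TimesDifferentiableWithinAt (2 * n) G (Ico 0 α) t →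
        (hankelK n G (Ico 0 α) t).PosSemidef) ∧
    (n = 2 → (fun t => f t / t) ∈ ClassQ 2 0 α) := by
  refine ⟨fun G hG t ht hd => hconv.hankelK_posSemidef hn hcont h0 hG ht hd, ?_⟩
  rintro rfl
  exact hconv.quotient_mem_classQ_two hcont h0
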